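/- Let $G$ be a discrete group with unit $e$. Let $X_G=\{\omega\subseteq G: e\in\omega\}$, a compact Hausdorff space as a subspace of $\{0,1\}^G$; for $t\in G$ let $X_t=\{\omega\in X_G: t\in\omega\}$ (a clopen set) with characteristic function $1_t$, and let $\theta_t:X_{t^{-1}}\to X_t$, $\theta_t(\omega)=t\omega$, be the canonical partial action of $G$ on $X_G$. A \emph{partial representation} of $G$ on a Hilbert space $H$ is a map $V:G\to B(H)$ with $V_e=1$, $V_{t^{-1}}=V_t^*$ and $V_sV_tV_{t^{-1}}=V_{st}V_{t^{-1}}$ for all $s,t\in G$. For each such $V$ there is a unique representation $\rho_V$ of $C(X_G)$ on $H$ with $\rho_V(1_t)=V_tV_t^*$ for all $t$. For a set $\mathcal R\subseteq C(X_G)$ of functions (relations), $V$ \emph{satisfies} $\mathcal R$ if $\rho_V(f)=0$ for all $f\in\mathcal R$. The \emph{spectrum} of $\mathcal R$ is the compact invariant set $$\Omega_{\mathcal R}=\{\omega\in X_G: f(t^{-1}\omega)=0\text{ for all }t\in\omega,\ f\in\mathcal R\}.$$ Restricting $\theta$ to $\Omega_{\mathcal R}$ gives a partial action $\alpha$ of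 $G$ on $C(\Omega_{\mathcal R})$: with $D_t=\{f\in C(\Omega_{\mathcal R}): f=0 \text{ off } X_t\}$, $\alpha_t:D_{t^{-1}}\to D_t$ is given by $\alpha_t(f)(\omega)=f(t^{-1}\omega)$ for $\omega\in\Omega_{\mathcal R}\cap X_t$. We also write $1_t$ for the restriction of $1_t$ to $\Omega_{\mathcal R}$. A \emph{covariant representation} of $(C(\Omega_{\mathcal R}),G,\alpha)$ on $H$ is a pair $(\rho,V)$ of a nondegenerate representation $\rho$ of $C(\Omega_{\mathcal R})$ and a partial representation $V$ of $G$ on $H$ such that for each $t$ the operator $V_tV_t^*$ is the projection onto $\overline{\operatorname{span}}\,\rho(D_t)H$ and $\rho(\alpha_t(a))=V_t\rho(a)V_{t^{-1}}$ for $a\in D_{t^{-1}}$. The (full) crossed product $C(\Omega_{\mathcal R})\rtimes_\alpha G$ is the completion of the $*$-algebra of finite sums $\sum_t a_t\delta_t$, $a_t\in D_t$, with $(a\delta_t)(b\delta_s)=\alpha_t(\alpha_{t^{-1}}(a)b)\delta_{ts}$ and $(a\delta_t)^*=\alpha_{t^{-1}}(a^*)\delta_{t^{-1}}$, in its largest $C^*$-seminorm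 dominated by $\sum_t\|a_t\|$. A partial representation $v$ is \emph{universal for} $\mathcal R$ if it satisfies $\mathcal R$ and, for every partial representation $V$ satisfying $\mathcal R$, the map $v_t\mapsto V_t$ extends to a $*$-homomorphism from $C^*(\{v_t:t\in G\})$ onto $C^*(\{V_t:t\in G\})$; then $C^*_p(G;\mathcal R):=C^*(\{v_t:t\in G\})$. \textbf{Theorem.} Let $\mathcal R\subseteq C(X_G)$ be a set of relations with spectrum $\Omega_{\mathcal R}$. (i) Every covariant representation $(\rho,V)$ of $(C(\Omega_{\mathcal R}),G,\alpha)$ on $H$ determines a unique representation $\rho\times V$ of $C(\Omega_{\mathcal R})\rtimes_\alpha G$ on $H$ with $(\rho\times V)(a\delta_t)=\rho(a)V_t$ for $a\in D_t$, every nondegenerate representation of $C(\Omega_{\mathcal R})\rtimes_\alpha G$ on $H$ is of the form $\rho\times V$ for exactly one covariant representation $(\rho,V)$, and the partial representation $V$ in every covariant representation $(\rho,V)$ satisfies the relations $\mathcal R$. (ii) Conversely, if $V$ is a partial representation of $G$ on $H$ satisfying $\mathcal R$, then $1_t\mapsto V_tV_t^*$ extends uniquely to a representation $\rho_V$ of $C(\Omega_{\mathcal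 R})$ on $H$, and $(\rho_V,V)$ is a covariant representation of $(C(\Omega_{\mathcal R}),G,\alpha)$. Hence $(\rho,V)\mapsto V$ is a bijection from the covariant representations of $(C(\Omega_{\mathcal R}),G,\alpha)$ on $H$ onto the partial representations of $G$ on $H$ satisfying $\mathcal R$. (iii) There is a partial representation of $G$ that is universal for $\mathcal R$, so that $C^*_p(G;\mathcal R)$ exists; and for every universal $v$ there is a unique $*$-isomorphism from $C(\Omega_{\mathcal R})\rtimes_\alpha G$ onto $C^*_p(G;\mathcal R)=C^*(\{v_t:t\in G\})$ that maps $1_t\delta_t$ to $v_t$ for every $t\in G$. -/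

import Mathlib

open scoped ComplexConjugate

universe u v w

noncomputable section

/-! ### Partial actions on spaces and the associated partial dynamical systems -/

/-- A partial action of the (discrete) group `G` on the space `X` by homeomorphisms
`θ_t : X_{t⁻¹} → X_t` between clopen sets `X_t = dom t`. The map `act t` represents `θ_t`;
its values outside `X_{t⁻¹}` play no role. -/
structure PartialAction (G : Type u) (X : Type v) [Group G] [TopologicalSpace X] where
  dom : G → Set X
  act : G → X → X
  isClopen_dom : ∀ t, IsClopen (dom t)
  continuousOn_act : ∀ t, ContinuousOn (act t) (dom t⁻¹)
  dom_one : dom 1 = Set.univ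
  act_one : ∀ x, act 1 x = x
  mapsTo_act : ∀ t, Set.MapsTo (act t) (dom t⁻¹) (dom t)
  /-- `θ_{st}` extends `θ_s ∘ θ_t`. -/
  act_mul : ∀ s t x, x ∈ dom t⁻¹ → act t x ∈ dom s⁻¹ →
    x ∈ dom (s * t)⁻¹ ∧ act (s * t) x = act s (act t x)

namespace PartialAction

variable {G : Type u} {X : Type v} [Group G] [TopologicalSpace X] (θ : PartialAction G X)

theorem mapsTo_inv {t : G} {x : X} (hx : x ∈ θ.dom t) : θ.act t⁻¹ x ∈ θ.dom t⁻¹ := by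
  have := θ.mapsTo_act t⁻¹
  rw [inv_inv] at this
  exact this hx

theorem act_inv_act {t : G} {x : X} (hx : x ∈ θ.dom t⁻¹) : θ.act t⁻¹ (θ.act t x) = x := by
  have h := (θ.act_mul t⁻¹ t x hx (by rw [inv_inv]; exact θ.mapsTo_act t hx)).2
  rw [inv_mul_cancel, θ.act_one] at h
  exact h.symm

/-- For `x ∈ X_s`: `x ∈ X_{st}` if and only if `θ_{s⁻¹}(x) ∈ X_t`, and then
`θ_{(st)⁻¹}(x) = θ_{t⁻¹}(θ_{s⁻¹}(x))`. -/
theorem dom_mul_iff {s t : G} {x : X} (hx : x ∈ θ.dom s) :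
    θ.act s⁻¹ x ∈ θ.dom t ↔ x ∈ θ.dom (s * t) := by
  constructor
  · intro h
    have := (θ.act_mul t⁻¹ s⁻¹ x (by rwa [inv_inv]) (by rwa [inv_inv])).1
    rwa [← mul_inv_rev, inv_inv] at this
  · intro h
    have h1 := θ.mapsTo_inv hx
    have h2 : θ.act s (θ.act s⁻¹ x) = x := by
      have := θ.act_inv_act (t := s⁻¹) (x := x) (by rwa [inv_inv])
      rwa [inv_inv] at this
    have := (θ.act_mul (s * t)⁻¹ s (θ.act s⁻¹ x) h1 (by rw [h2, inv_inv]; exact h)).1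
    simpa using this

theorem act_mul_inv {s t : G} {x : X} (hx : x ∈ θ.dom s) (h : θ.act s⁻¹ x ∈ θ.dom t) :
    θ.act (s * t)⁻¹ x = θ.act t⁻¹ (θ.act s⁻¹ x) := by
  have := (θ.act_mul t⁻¹ s⁻¹ x (by rwa [inv_inv]) (by rwa [inv_inv])).2
  rwa [← mul_inv_rev] at this

/-- The closed ideal `D_t = C_0(X_t)` of `C(X)`. -/
def ideal (t : G) : Ideal C(X, ℂ) where
  carrier := {f | ∀ x, x ∉ θ.dom t → f x = 0}
  add_mem' := fun {a b} ha hb x hx => by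
    simp only [ContinuousMap.add_apply]
    rw [ha x hx, hb x hx, add_zero]
  zero_mem' := fun x _ => rfl
  smul_mem' := fun c f hf x hx => by
    simp only [smul_eq_mul, ContinuousMap.mul_apply]
    rw [hf x hx, mul_zero]

theorem mem_ideal {t : G} {f : C(X, ℂ)} : f ∈ θ.ideal t ↔ ∀ x, x ∉ θ.dom t → f x = 0 :=
  Iff.rfl

open Classical in
/-- The characteristic function `1_t` of the clopen set `X_t`. -/
def char (t : G) : C(X, ℂ) where
  toFun x := if x ∈ θ.dom t then 1 else 0
  continuous_toFun := by
    refine continuous_if ?_ continuousOn_const continuousOn_const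
    intro a ha
    have : a ∈ frontier (θ.dom t) := ha
    rw [(θ.isClopen_dom t).frontier_eq] at this
    exact this.elim

theorem char_mem_ideal (t : G) : θ.char t ∈ θ.ideal t := fun _ hx => if_neg hx

open Classical in
/-- `θ.alpha t f` is `α_t(f 1_{t⁻¹})`, the function equal to `f(θ_{t⁻¹}(x))` for `x ∈ X_t` and
to `0` elsewhere. Its restriction to `D_{t⁻¹}` is the partial automorphism
`α_t : D_{t⁻¹} → D_t`. -/
def alpha (t : G) (f : C(X, ℂ)) : C(X, ℂ) where
  toFun x := if x ∈ θ.dom t then f (θ.act t⁻¹ x) else 0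
  continuous_toFun := by
    refine continuous_if ?_ ?_ continuousOn_const
    · intro a ha
      have : a ∈ frontier (θ.dom t) := ha
      rw [(θ.isClopen_dom t).frontier_eq] at this
      exact this.elim
    · have h1 : closure {x | x ∈ θ.dom t} = θ.dom t := (θ.isClopen_dom t).isClosed.closure_eq
      rw [h1]
      have h2 := θ.continuousOn_act t⁻¹
      rw [inv_inv] at h2
      exact f.continuous.comp_continuousOn h2

theorem alpha_apply_mem {t : G} {x : X} (hx : x ∈ θ.dom t) (f : C(X, ℂ)) :
    θ.alpha t f x = f (θ.act t⁻¹ x) := if_pos hx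

theorem alpha_apply_notMem {t : G} {x : X} (hx : x ∉ θ.dom t) (f : C(X, ℂ)) :
    θ.alpha t f x = 0 := if_neg hx

theorem alpha_mem_ideal (t : G) (f : C(X, ℂ)) : θ.alpha t f ∈ θ.ideal t :=
  fun _ hx => if_neg hx

theorem alpha_add (t : G) (f g : C(X, ℂ)) : θ.alpha t (f + g) = θ.alpha t f + θ.alpha t g := by
  ext x
  by_cases hx : x ∈ θ.dom t <;> simp [alpha, hx]

theorem alpha_smul (t : G) (c : ℂ) (f : C(X, ℂ)) : θ.alpha t (c • f) = c • θ.alpha t f := by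
  ext x
  by_cases hx : x ∈ θ.dom t <;> simp [alpha, hx]

theorem alpha_mul (t : G) (f g : C(X, ℂ)) : θ.alpha t (f * g) = θ.alpha t f * θ.alpha t g := by
  ext x
  by_cases hx : x ∈ θ.dom t <;> simp [alpha, hx]

theorem alpha_star (t : G) (f : C(X, ℂ)) : θ.alpha t (star f) = star (θ.alpha t f) := by
  ext x
  by_cases hx : x ∈ θ.dom t <;> simp [alpha, hx]

theorem alpha_one (f : C(X, ℂ)) : θ.alpha 1 f = f := by
  ext x
  simp [alpha, θ.dom_one, θ.act_one]

theorem alpha_alpha (s t : G) (f : C(X, ℂ)) :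
    θ.alpha s (θ.alpha t f) = θ.char s * θ.alpha (s * t) f := by
  ext x
  by_cases hx : x ∈ θ.dom s
  · by_cases hy : θ.act s⁻¹ x ∈ θ.dom t
    · have h := (θ.dom_mul_iff hx).1 hy
      rw [θ.alpha_apply_mem hx, θ.alpha_apply_mem hy, ContinuousMap.mul_apply,
        θ.alpha_apply_mem h, θ.act_mul_inv hx hy]
      simp [char, hx]
    · have h := mt (θ.dom_mul_iff hx).2 hy
      rw [θ.alpha_apply_mem hx, θ.alpha_apply_notMem hy, ContinuousMap.mul_apply,
        θ.alpha_apply_notMem h, mul_zero]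
  · simp [alpha, char, hx]

theorem mul_char {t : G} {f : C(X, ℂ)} (hf : f ∈ θ.ideal t) : f * θ.char t = f := by
  ext x
  by_cases hx : x ∈ θ.dom t
  · simp [char, hx]
  · simp [hf x hx]

theorem alpha_alpha_inv {t : G} {f : C(X, ℂ)} : θ.alpha t (θ.alpha t⁻¹ f) = θ.char t * f := by
  rw [alpha_alpha, mul_inv_cancel, alpha_one]

/-- Shortcut instance. -/
instance instAddCommGroupContinuousFunctions : AddCommGroup C(X, ℂ) := inferInstance

/-! ### The convolution `*`-algebra of finite sums `∑ a_t δ_t`, `a_t ∈ D_t` -/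

/-- The product of `a δ_t` and `b δ_s`, namely `α_t(α_{t⁻¹}(a) b) δ_{ts}`, extended bilinearly. -/
def convMul (F K : G →₀ C(X, ℂ)) : G →₀ C(X, ℂ) :=
  F.sum fun t a => K.sum fun s b => Finsupp.single (t * s) (θ.alpha t (θ.alpha t⁻¹ a * b))

/-- The involution, `(a δ_t)^* = α_{t⁻¹}(a^*) δ_{t⁻¹}`, extended conjugate-linearly. -/
def convStar (F : G →₀ C(X, ℂ)) : G →₀ C(X, ℂ) :=
  F.sum fun t a => Finsupp.single t⁻¹ (θ.alpha t⁻¹ (star a))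

/-- The finitely supported sections `t ↦ a_t ∈ D_t`. -/
def sections : Submodule ℂ (G →₀ C(X, ℂ)) where
  carrier := {F | ∀ t, F t ∈ θ.ideal t}
  add_mem' := fun ha hb t => (θ.ideal t).add_mem (ha t) (hb t)
  zero_mem' := fun t => (θ.ideal t).zero_mem
  smul_mem' := fun c F hF t x hx => by
    simp only [Finsupp.smul_apply, ContinuousMap.smul_apply]
    rw [hF t x hx, smul_zero]

theorem single_mem_sections {t : G} {a : C(X, ℂ)} (ha : a ∈ θ.ideal t) :
    Finsupp.single t a ∈ θ.sections := by
  classical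
  intro s
  rw [Finsupp.single_apply]
  split_ifs with h
  · exact h ▸ ha
  · exact (θ.ideal s).zero_mem

theorem alpha_one_right (t : G) : θ.alpha t 1 = θ.char t := by
  ext x
  by_cases hx : x ∈ θ.dom t <;> simp [alpha, char, hx]

theorem char_mul_char (t : G) : θ.char t * θ.char t = θ.char t := θ.mul_char (θ.char_mem_ideal t)

theorem char_mul_alpha (t : G) (f : C(X, ℂ)) : θ.char t * θ.alpha t f = θ.alpha t f := by
  rw [mul_comm, θ.mul_char (θ.alpha_mem_ideal t f)]

theorem alpha_zero (t : G) : θ.alpha t 0 = 0 := by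
  ext x
  simp [alpha]

/-- The coefficient of a product of two elementary terms, without the inner `α_{t⁻¹}`. -/
theorem alpha_mul_coeff (t : G) (a b : C(X, ℂ)) :
    θ.alpha t (θ.alpha t⁻¹ a * b) = a * θ.alpha t b := by
  rw [alpha_mul, alpha_alpha_inv, mul_comm (θ.char t), mul_assoc, char_mul_alpha]

theorem char_star (t : G) : star (θ.char t) = θ.char t := by
  ext x
  by_cases hx : x ∈ θ.dom t <;> simp [char, hx]

theorem convMul_single (t s : G) (a b : C(X, ℂ)) :
    θ.convMul (Finsupp.single t a) (Finsupp.single s b)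
      = Finsupp.single (t * s) (a * θ.alpha t b) := by
  unfold convMul
  rw [Finsupp.sum_single_index, Finsupp.sum_single_index, alpha_mul_coeff]
  · simp [alpha_zero]
  · simp [alpha_zero]

theorem convMul_add_left (F F' K : G →₀ C(X, ℂ)) :
    θ.convMul (F + F') K = θ.convMul F K + θ.convMul F' K := by
  unfold convMul
  rw [Finsupp.sum_add_index']
  · intro t; simp [alpha_zero]
  · intro t a b
    simp only [alpha_add, add_mul, Finsupp.single_add]
    exact Finsupp.sum_add

theorem convMul_add_right (F K K' : G →₀ C(X, ℂ)) :
    θ.convMul F (K + K') = θ.convMul F K + θ.convMul F K' := by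
  unfold convMul
  rw [← Finsupp.sum_add]
  refine Finsupp.sum_congr fun t _ => ?_
  rw [Finsupp.sum_add_index']
  · intro t; simp [alpha_zero]
  · intro t a b
    simp only [alpha_add, mul_add, Finsupp.single_add]

theorem convMul_zero_left (K : G →₀ C(X, ℂ)) : θ.convMul 0 K = 0 := by
  simp [convMul]

theorem convMul_zero_right (F : G →₀ C(X, ℂ)) : θ.convMul F 0 = 0 := by
  simp [convMul]

theorem convMul_smul_left (c : ℂ) (F K : G →₀ C(X, ℂ)) :
    θ.convMul (c • F) K = c • θ.convMul F K := by
  induction F using Finsupp.induction_linear with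
  | zero => simp [convMul_zero_left]
  | add F F' h h' => simp [convMul_add_left, h, h']
  | single t a =>
    induction K using Finsupp.induction_linear with
    | zero => simp [convMul_zero_right]
    | add F F' h h' => simp only [convMul_add_right, h, h', smul_add]
    | single s b => simp only [convMul_single, Finsupp.smul_single, smul_mul_assoc]

theorem convMul_smul_right (c : ℂ) (F K : G →₀ C(X, ℂ)) :
    θ.convMul F (c • K) = c • θ.convMul F K := by
  induction F using Finsupp.induction_linear with
  | zero => simp [convMul_zero_left]
  | add F F' h h' => simp [convMul_add_left, h, h']
  | single t a =>
    induction K using Finsupp.induction_linear with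
    | zero => simp [convMul_zero_right]
    | add F F' h h' => simp only [convMul_add_right, h, h', smul_add]
    | single s b => simp only [convMul_single, Finsupp.smul_single, alpha_smul, mul_smul_comm]

theorem convMul_assoc (F K L : G →₀ C(X, ℂ)) :
    θ.convMul (θ.convMul F K) L = θ.convMul F (θ.convMul K L) := by
  induction F using Finsupp.induction_linear with
  | zero => simp [convMul_zero_left]
  | add F F' h h' => simp only [convMul_add_left, h, h']
  | single t a =>
    induction K using Finsupp.induction_linear with
    | zero => simp [convMul_zero_right, convMul_zero_left]
    | add F F' h h' => simp only [convMul_add_right, convMul_add_left, h, h']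
    | single s b =>
      induction L using Finsupp.induction_linear with
      | zero => simp [convMul_zero_right]
      | add F F' h h' => simp only [convMul_add_right, h, h']
      | single r c =>
        simp only [convMul_single, mul_assoc, alpha_mul, alpha_alpha]
        congr 2
        rw [← mul_assoc (θ.alpha t b), mul_comm (θ.alpha t b) (θ.char t), char_mul_alpha]

theorem convStar_single (t : G) (a : C(X, ℂ)) :
    θ.convStar (Finsupp.single t a) = Finsupp.single t⁻¹ (θ.alpha t⁻¹ (star a)) := by
  unfold convStar
  rw [Finsupp.sum_single_index]
  simp [alpha_zero]

theorem convStar_add (F K : G →₀ C(X, ℂ)) :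
    θ.convStar (F + K) = θ.convStar F + θ.convStar K := by
  unfold convStar
  rw [Finsupp.sum_add_index']
  · intro t; simp [alpha_zero]
  · intro t a b
    simp [alpha_add]

theorem convStar_zero : θ.convStar 0 = 0 := by simp [convStar]

theorem convStar_smul (c : ℂ) (F : G →₀ C(X, ℂ)) :
    θ.convStar (c • F) = conj c • θ.convStar F := by
  induction F using Finsupp.induction_linear with
  | zero => simp [convStar_zero]
  | add F F' h h' => simp only [smul_add, convStar_add, h, h']
  | single t a => simp [Finsupp.smul_single, convStar_single, ← alpha_smul]

theorem convStar_convMul (F K : G →₀ C(X, ℂ)) :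
    θ.convStar (θ.convMul F K) = θ.convMul (θ.convStar K) (θ.convStar F) := by
  induction F using Finsupp.induction_linear with
  | zero => simp [convMul_zero_left, convMul_zero_right, convStar_zero]
  | add F F' h h' => simp only [convMul_add_left, convMul_add_right, convStar_add, h, h']
  | single t a =>
    induction K using Finsupp.induction_linear with
    | zero => simp [convMul_zero_left, convMul_zero_right, convStar_zero]
    | add F F' h h' => simp only [convMul_add_left, convMul_add_right, convStar_add, h, h']
    | single s b =>
      simp only [convMul_single, convStar_single, mul_inv_rev, star_mul, ← alpha_star,
        alpha_mul, alpha_alpha]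
      congr 1
      rw [inv_mul_cancel_right]
      calc _ = θ.alpha s⁻¹ (star b) * (θ.char (s⁻¹ * t⁻¹) * θ.alpha (s⁻¹ * t⁻¹) (star a)) := by ring
        _ = (θ.char s⁻¹ * θ.alpha s⁻¹ (star b)) * θ.alpha (s⁻¹ * t⁻¹) (star a) := by
          rw [char_mul_alpha, char_mul_alpha]
        _ = _ := by ring

theorem convMul_mem {F K : G →₀ C(X, ℂ)} (hF : F ∈ θ.sections) (hK : K ∈ θ.sections) :
    θ.convMul F K ∈ θ.sections := by
  refine Submodule.sum_mem _ fun t _ => Submodule.sum_mem _ fun s _ => ?_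
  refine θ.single_mem_sections ?_
  rw [alpha_mul_coeff]
  intro x hx
  by_cases h : x ∈ θ.dom t
  · have := mt (θ.dom_mul_iff h).1 hx
    rw [ContinuousMap.mul_apply, θ.alpha_apply_mem h, hK s _ this, mul_zero]
  · rw [ContinuousMap.mul_apply, hF t x h, zero_mul]

theorem convStar_mem (F : G →₀ C(X, ℂ)) : θ.convStar F ∈ θ.sections :=
  Submodule.sum_mem _ fun _ _ => θ.single_mem_sections (θ.alpha_mem_ideal _ _)

theorem convStar_convStar {F : G →₀ C(X, ℂ)} (hF : F ∈ θ.sections) :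
    θ.convStar (θ.convStar F) = F := by
  have key : ∀ K : G →₀ C(X, ℂ), θ.convStar (θ.convStar K)
      = K.sum fun t a => Finsupp.single t (θ.char t * a) := by
    intro K
    induction K using Finsupp.induction_linear with
    | zero => simp [convStar_zero]
    | add F F' h h' =>
      rw [convStar_add, convStar_add, h, h', Finsupp.sum_add_index'] <;> simp [mul_add]
    | single t a =>
      rw [convStar_single, convStar_single, Finsupp.sum_single_index (by simp)]
      simp only [← alpha_star, star_star, inv_inv, alpha_alpha_inv]
  rw [key]
  conv_rhs => rw [← Finsupp.sum_single F]
  refine Finsupp.sum_congr fun t _ => ?_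
  rw [mul_comm, θ.mul_char (hF t)]

theorem one_convMul (F : G →₀ C(X, ℂ)) : θ.convMul (Finsupp.single 1 1) F = F := by
  induction F using Finsupp.induction_linear with
  | zero => simp [convMul_zero_right]
  | add F F' h h' => simp only [convMul_add_right, h, h']
  | single t a => simp [convMul_single, alpha_one]

theorem convMul_one {F : G →₀ C(X, ℂ)} (hF : F ∈ θ.sections) :
    θ.convMul F (Finsupp.single 1 1) = F := by
  unfold convMul
  conv_rhs => rw [← Finsupp.sum_single F]
  refine Finsupp.sum_congr fun t _ => ?_
  rw [Finsupp.sum_single_index (by simp [alpha_zero]), alpha_mul_coeff, alpha_one_right, mul_one,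
    θ.mul_char (hF t)]

/-- The convolution `*`-algebra of finite sums `∑ a_t δ_t` with `a_t ∈ D_t`. -/
def ConvAlgebra : Type (max u v) := θ.sections

namespace ConvAlgebra

instance : AddCommGroup θ.ConvAlgebra := inferInstanceAs (AddCommGroup θ.sections)
instance : Module ℂ θ.ConvAlgebra := inferInstanceAs (Module ℂ θ.sections)
instance : Mul θ.ConvAlgebra := ⟨fun F K => ⟨θ.convMul F.1 K.1, θ.convMul_mem F.2 K.2⟩⟩
instance : One θ.ConvAlgebra :=
  ⟨⟨Finsupp.single 1 1, θ.single_mem_sections fun x hx => (hx (θ.dom_one ▸ Set.mem_univ x)).elim⟩⟩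
instance : Star θ.ConvAlgebra := ⟨fun F => ⟨θ.convStar F.1, θ.convStar_mem F.1⟩⟩

instance : Ring θ.ConvAlgebra where
  __ := (inferInstance : AddCommGroup θ.ConvAlgebra)
  mul := (· * ·)
  one := 1
  left_distrib F K L := Subtype.ext (θ.convMul_add_right F.1 K.1 L.1)
  right_distrib F K L := Subtype.ext (θ.convMul_add_left F.1 K.1 L.1)
  zero_mul F := Subtype.ext (θ.convMul_zero_left F.1)
  mul_zero F := Subtype.ext (θ.convMul_zero_right F.1)
  mul_assoc F K L := Subtype.ext (θ.convMul_assoc F.1 K.1 L.1)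
  one_mul F := Subtype.ext (θ.one_convMul F.1)
  mul_one F := Subtype.ext (θ.convMul_one F.2)

instance : Algebra ℂ θ.ConvAlgebra :=
  Algebra.ofModule (fun c F K => Subtype.ext (θ.convMul_smul_left c F.1 K.1))
    (fun c F K => Subtype.ext (θ.convMul_smul_right c F.1 K.1))

instance : StarRing θ.ConvAlgebra where
  star_involutive F := Subtype.ext (θ.convStar_convStar F.2)
  star_mul F K := Subtype.ext (θ.convStar_convMul F.1 K.1)
  star_add F K := Subtype.ext (θ.convStar_add F.1 K.1)

instance : StarModule ℂ θ.ConvAlgebra where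
  star_smul c F := Subtype.ext (θ.convStar_smul c F.1)

/-- The element `a δ_t`, for `a ∈ D_t`. -/
def delta (t : G) (a : θ.ideal t) : θ.ConvAlgebra :=
  ⟨Finsupp.single t a.1, θ.single_mem_sections a.2⟩

end ConvAlgebra

/-! ### The full crossed product as enveloping `C^*`-algebra -/

section CrossedProduct

variable [CompactSpace X]

/-- The norm `‖∑ a_t δ_t‖₁ = ∑ ‖a_t‖`. -/
def l1Norm (F : θ.ConvAlgebra) : ℝ := F.1.sum fun _ a => ‖a‖

/-- `C^*`-seminorms on the convolution algebra that are dominated by the `ℓ¹`-norm. -/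
structure IsCStarSeminorm (p : Seminorm ℂ θ.ConvAlgebra) : Prop where
  mul_le : ∀ F K, p (F * K) ≤ p F * p K
  star_mul_self : ∀ F, p (star F * F) = p F ^ 2
  le_l1Norm : ∀ F, p F ≤ θ.l1Norm F

/-- The largest `C^*`-seminorm on the convolution algebra dominated by the `ℓ¹`-norm. -/
def envNorm (F : θ.ConvAlgebra) : ℝ :=
  ⨆ p : {p : Seminorm ℂ θ.ConvAlgebra // θ.IsCStarSeminorm p}, p.1 F

theorem l1Norm_nonneg (F : θ.ConvAlgebra) : 0 ≤ θ.l1Norm F :=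
  Finset.sum_nonneg fun _ _ => norm_nonneg _

theorem isCStarSeminorm_zero : θ.IsCStarSeminorm 0 :=
  ⟨fun F K => by simp, fun F => by simp, fun F => by simpa using θ.l1Norm_nonneg F⟩

instance : Nonempty {p : Seminorm ℂ θ.ConvAlgebra // θ.IsCStarSeminorm p} :=
  ⟨⟨0, θ.isCStarSeminorm_zero⟩⟩

theorem bddAbove_envNorm (F : θ.ConvAlgebra) : BddAbove (Set.range
    fun p : {p : Seminorm ℂ θ.ConvAlgebra // θ.IsCStarSeminorm p} => p.1 F) :=
  ⟨θ.l1Norm F, by rintro _ ⟨p, rfl⟩; exact p.2.le_l1Norm F⟩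

theorem le_envNorm (p : {p : Seminorm ℂ θ.ConvAlgebra // θ.IsCStarSeminorm p})
    (F : θ.ConvAlgebra) : p.1 F ≤ θ.envNorm F := le_ciSup (θ.bddAbove_envNorm F) p

theorem envNorm_nonneg (F : θ.ConvAlgebra) : 0 ≤ θ.envNorm F :=
  (apply_nonneg _ F).trans (θ.le_envNorm ⟨0, θ.isCStarSeminorm_zero⟩ F)

theorem envNorm_mul_le (F K : θ.ConvAlgebra) : θ.envNorm (F * K) ≤ θ.envNorm F * θ.envNorm K :=
  ciSup_le fun p => (p.2.mul_le F K).trans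
    (mul_le_mul (θ.le_envNorm p F) (θ.le_envNorm p K) (apply_nonneg _ _) (θ.envNorm_nonneg F))

theorem envNorm_star_le (F : θ.ConvAlgebra) : θ.envNorm (star F) ≤ θ.envNorm F := by
  refine ciSup_le fun p => le_trans ?_ (θ.le_envNorm p F)
  have h1 := p.2.star_mul_self (star F)
  have h2 := p.2.mul_le (star (star F)) (star F)
  rw [star_star] at h1 h2
  by_contra! h
  nlinarith [apply_nonneg p.1 F, apply_nonneg p.1 (star F)]

theorem envNorm_star_mul_self (F : θ.ConvAlgebra) :
    θ.envNorm F * θ.envNorm F ≤ θ.envNorm (star F * F) := by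
  have h : θ.envNorm F ≤ √(θ.envNorm (star F * F)) := by
    refine ciSup_le fun p => Real.le_sqrt_of_sq_le ?_
    rw [← p.2.star_mul_self]
    exact θ.le_envNorm p _
  calc _ ≤ √(θ.envNorm (star F * F)) * √(θ.envNorm (star F * F)) :=
        mul_le_mul h h (θ.envNorm_nonneg F) (Real.sqrt_nonneg _)
    _ = _ := Real.mul_self_sqrt (θ.envNorm_nonneg _)

/-- `envNorm` as a seminorm. -/
def envSeminorm : Seminorm ℂ θ.ConvAlgebra :=
  Seminorm.of θ.envNorm
    (fun F K => ciSup_le fun p => (map_add_le_add p.1 F K).trans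
      (add_le_add (θ.le_envNorm p F) (θ.le_envNorm p K)))
    (fun c F => by
      unfold envNorm
      rw [Real.mul_iSup_of_nonneg (norm_nonneg c)]
      simp only [map_smul_eq_mul])

namespace ConvAlgebra

instance : SeminormedAddCommGroup θ.ConvAlgebra :=
  θ.envSeminorm.toAddGroupSeminorm.toSeminormedAddCommGroup

instance : SeminormedRing θ.ConvAlgebra where
  __ := (inferInstance : Ring θ.ConvAlgebra)
  __ := (inferInstance : SeminormedAddCommGroup θ.ConvAlgebra)
  norm_mul_le F K := θ.envNorm_mul_le F K

instance : NormedSpace ℂ θ.ConvAlgebra where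
  norm_smul_le c F := (map_smul_eq_mul θ.envSeminorm c F).le

theorem norm_def (F : θ.ConvAlgebra) : ‖F‖ = θ.envNorm F := rfl

instance : NormedStarGroup θ.ConvAlgebra where
  norm_star_le F := θ.envNorm_star_le F

end ConvAlgebra

/-- The full crossed product `C(X) ⋊_α G`: the (Hausdorff) completion of the convolution algebra
in its largest `C^*`-seminorm dominated by the `ℓ¹`-norm, i.e. the enveloping `C^*`-algebra of
the `ℓ¹`-algebra of `(C(X), G, α)`. -/
def CrossedProduct : Type (max u v) := UniformSpace.Completion θ.ConvAlgebra

namespace CrossedProduct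

open UniformSpace

instance : NormedRing θ.CrossedProduct := inferInstanceAs (NormedRing (Completion θ.ConvAlgebra))
instance : CompleteSpace θ.CrossedProduct :=
  inferInstanceAs (CompleteSpace (Completion θ.ConvAlgebra))
instance : NormedSpace ℂ θ.CrossedProduct :=
  inferInstanceAs (NormedSpace ℂ (Completion θ.ConvAlgebra))

/-- The canonical map of the convolution algebra into the crossed product. -/
def of (F : θ.ConvAlgebra) : θ.CrossedProduct := (F : Completion θ.ConvAlgebra)

instance : Star θ.CrossedProduct := ⟨Completion.map (star : θ.ConvAlgebra → θ.ConvAlgebra)⟩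

theorem continuous_star' : Continuous (star : θ.CrossedProduct → θ.CrossedProduct) :=
  Completion.continuous_map

theorem denseRange_of : DenseRange (of θ) := Completion.denseRange_coe

theorem continuous_of : Continuous (of θ) := Completion.continuous_coe _

theorem star_of (F : θ.ConvAlgebra) : star (of θ F) = of θ (star F) :=
  Completion.map_coe ((starₗᵢ ℂ : θ.ConvAlgebra ≃ₗᵢ⋆[ℂ] θ.ConvAlgebra).isometry.uniformContinuous) F

theorem of_add (F K : θ.ConvAlgebra) : of θ (F + K) = of θ F + of θ K := Completion.coe_add F K
theorem of_mul (F K : θ.ConvAlgebra) : of θ (F * K) = of θ F * of θ K := Completion.coe_mul F K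
theorem of_smul (c : ℂ) (F : θ.ConvAlgebra) : of θ (c • F) = c • of θ F := Completion.coe_smul c F
theorem norm_of (F : θ.ConvAlgebra) : ‖of θ F‖ = θ.envNorm F := Completion.norm_coe F

theorem induction_of {P : θ.CrossedProduct → Prop} (hc : IsClosed {x | P x})
    (h : ∀ F, P (of θ F)) (x : θ.CrossedProduct) : P x :=
  Completion.induction_on (p := P) x hc h

theorem smul_mul' (c : ℂ) (x y : θ.CrossedProduct) : (c • x) * y = c • (x * y) := by
  induction x using induction_of with
  | hc => exact isClosed_eq (((continuous_const_smul c).mul continuous_const))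
            ((continuous_id.mul continuous_const).const_smul c)
  | h F =>
    induction y using induction_of with
    | hc => exact isClosed_eq (continuous_const.mul continuous_id)
              ((continuous_const.mul continuous_id).const_smul c)
    | h K => rw [← of_smul, ← of_mul, ← of_mul, ← of_smul, smul_mul_assoc]

theorem mul_smul' (c : ℂ) (x y : θ.CrossedProduct) : x * (c • y) = c • (x * y) := by
  induction x using induction_of with
  | hc => exact isClosed_eq (continuous_id.mul continuous_const)
            ((continuous_id.mul continuous_const).const_smul c)
  | h F =>
    induction y using induction_of with
    | hc => exact isClosed_eq (continuous_const.mul (continuous_const_smul c))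
              ((continuous_const.mul continuous_id).const_smul c)
    | h K => rw [← of_smul, ← of_mul, ← of_mul, ← of_smul, mul_smul_comm]

instance : Algebra ℂ θ.CrossedProduct := Algebra.ofModule (smul_mul' θ) (mul_smul' θ)

instance : NormedAlgebra ℂ θ.CrossedProduct where
  norm_smul_le c x := norm_smul_le c x

instance : StarRing θ.CrossedProduct where
  star_involutive x := by
    induction x using induction_of with
    | hc => exact isClosed_eq ((continuous_star' θ).comp (continuous_star' θ)) continuous_id
    | h F => rw [star_of, star_of, star_star]
  star_mul x y := by
    induction x using induction_of with
    | hc => exact isClosed_eq ((continuous_star' θ).comp (continuous_id.mul continuous_const))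
              (continuous_const.mul (continuous_star' θ))
    | h F =>
      induction y using induction_of with
      | hc => exact isClosed_eq ((continuous_star' θ).comp (continuous_const.mul continuous_id))
                ((continuous_star' θ).mul continuous_const)
      | h K => rw [← of_mul, star_of, star_of, star_of, star_mul, of_mul]
  star_add x y := by
    induction x using induction_of with
    | hc => exact isClosed_eq ((continuous_star' θ).comp (continuous_id.add continuous_const))
              ((continuous_star' θ).add continuous_const)
    | h F =>
      induction y using induction_of with
      | hc => exact isClosed_eq ((continuous_star' θ).comp (continuous_const.add continuous_id))
                (continuous_const.add (continuous_star' θ))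
      | h K => rw [← of_add, star_of, star_of, star_of, star_add, of_add]

instance : StarModule ℂ θ.CrossedProduct where
  star_smul c x := by
    induction x using induction_of with
    | hc => exact isClosed_eq ((continuous_star' θ).comp (continuous_const_smul c))
              ((continuous_const_smul (star c)).comp (continuous_star' θ))
    | h F => rw [← of_smul, star_of, star_of, star_smul, of_smul]

instance : CStarRing θ.CrossedProduct where
  norm_mul_self_le x := by
    induction x using induction_of with
    | hc => exact isClosed_le (continuous_norm.mul continuous_norm)
              (((continuous_star' θ).mul continuous_id).norm)
    | h F =>
      rw [star_of, ← of_mul, norm_of, norm_of]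
      exact θ.envNorm_star_mul_self F

instance : CStarAlgebra θ.CrossedProduct where

/-- The element `a δ_t` of the crossed product, for `a ∈ D_t`. -/
def delta (t : G) (a : θ.ideal t) : θ.CrossedProduct := of θ (ConvAlgebra.delta θ t a)

/-- The partial isometry `1_t δ_t` of the crossed product. -/
def partialIsometry (t : G) : θ.CrossedProduct := delta θ t ⟨θ.char t, θ.char_mem_ideal t⟩

end CrossedProduct
end CrossedProduct

/-! ### Restriction of a partial action to an invariant subset -/

open Classical in
/-- The restriction of a partial action to an invariant subset `Ω`. -/
def restrict (Ω : Set X) (h : ∀ t, ∀ x ∈ Ω, x ∈ θ.dom t⁻¹ → θ.act t x ∈ Ω) :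
    PartialAction G Ω where
  dom t := {x | x.1 ∈ θ.dom t}
  act t x := if hx : x.1 ∈ θ.dom t⁻¹ then ⟨θ.act t x.1, h t x.1 x.2 hx⟩ else x
  isClopen_dom t := (θ.isClopen_dom t).preimage continuous_subtype_val
  continuousOn_act t := by
    rw [Topology.IsInducing.subtypeVal.continuousOn_iff]
    refine ContinuousOn.congr (f := fun x : Ω => θ.act t x.1) ?_ ?_
    · exact (θ.continuousOn_act t).comp continuous_subtype_val.continuousOn fun x hx => hx
    · intro x hx
      have hx' : x.1 ∈ θ.dom t⁻¹ := hx
      simp [hx']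
  dom_one := by simp [θ.dom_one]
  act_one x := by
    split_ifs with hx
    · exact Subtype.ext (θ.act_one x.1)
    · rfl
  mapsTo_act t x hx := by
    have hx' : x.1 ∈ θ.dom t⁻¹ := hx
    simpa [hx'] using θ.mapsTo_act t hx'
  act_mul s t x hx hy := by
    have hx' : x.1 ∈ θ.dom t⁻¹ := hx
    simp only [hx', dite_true] at hy ⊢
    change θ.act t x.1 ∈ θ.dom s⁻¹ at hy
    have := θ.act_mul s t x.1 hx' hy
    refine ⟨this.1, ?_⟩
    rw [dif_pos this.1, dif_pos hy]
    exact Subtype.ext this.2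

end PartialAction

/-! ### The space `X_G` and the spectrum of a set of relations -/

/-- The compact space `X_G` of the subsets of `G` that contain the unit, as a subspace of
`{0,1}^G`; the value `true` means membership. -/
abbrev XG (G : Type u) [Group G] : Type u := {ω : G → Bool // ω 1 = true}

section Spectrum

variable {G : Type u} [Group G]

theorem isClosed_XG : IsClosed {ω : G → Bool | ω 1 = true} :=
  isClosed_eq (continuous_apply 1) continuous_const

instance : CompactSpace (XG G) := isCompact_iff_compactSpace.1 (isClosed_XG (G := G)).isCompact

open Classical in
/-- The translate `tω = {tx : x ∈ ω}`, an element of `X_G` when `t⁻¹ ∈ ω`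
(with an irrelevant value otherwise). -/
def XG.translate (t : G) (ω : XG G) : XG G :=
  if h : ω.1 t⁻¹ = true then ⟨fun x => ω.1 (t⁻¹ * x), by simpa using h⟩ else ω

theorem XG.translate_apply {t : G} {ω : XG G} (h : ω.1 t⁻¹ = true) (x : G) :
    (ω.translate t).1 x = ω.1 (t⁻¹ * x) := by
  simp [XG.translate, h]

theorem XG.translate_translate {s t : G} {ω : XG G} (h : ω.1 t⁻¹ = true)
    (h' : (ω.translate t).1 s⁻¹ = true) :
    ω.1 (s * t)⁻¹ = true ∧ ω.translate (s * t) = (ω.translate t).translate s := by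
  have h1 : ω.1 (s * t)⁻¹ = true := by
    rw [XG.translate_apply h] at h'
    simpa using h'
  refine ⟨h1, Subtype.ext (funext fun x => ?_)⟩
  rw [XG.translate_apply h1, XG.translate_apply h', XG.translate_apply h]
  simp [mul_assoc]

variable (G) in
/-- The canonical partial action of `G` on `X_G`: `X_t = {ω : t ∈ ω}` and `θ_t(ω) = tω` for
`ω ∈ X_{t⁻¹}`. -/
def canonicalAction : PartialAction G (XG G) where
  dom t := {ω | ω.1 t = true}
  act := XG.translate
  isClopen_dom t :=
    (isClopen_discrete {true}).preimage ((continuous_apply t).comp continuous_subtype_val)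
  continuousOn_act t := by
    rw [Topology.IsInducing.continuousOn_iff (g := (Subtype.val : XG G → G → Bool)) ⟨rfl⟩]
    refine ContinuousOn.congr (f := fun ω : XG G => fun x => ω.1 (t⁻¹ * x)) ?_ ?_
    · refine Continuous.continuousOn ?_
      exact continuous_pi fun x => (continuous_apply (t⁻¹ * x)).comp continuous_subtype_val
    · intro ω hω
      exact funext fun x => XG.translate_apply hω x
  dom_one := Set.eq_univ_of_forall fun ω => ω.2
  act_one ω := by
    refine Subtype.ext (funext fun x => ?_)
    rw [XG.translate_apply (by simpa using ω.2)]
    simp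
  mapsTo_act t ω hω := by
    show (ω.translate t).1 t = true
    rw [XG.translate_apply hω]
    simpa using ω.2
  act_mul s t ω h h' := XG.translate_translate h h'

/-- The spectrum `Ω_R = {ω ∈ X_G : f(t⁻¹ω) = 0 for all t ∈ ω, f ∈ R}`. -/
def spectrumOf (R : Set C(XG G, ℂ)) : Set (XG G) :=
  {ω | ∀ t, ω.1 t = true → ∀ f ∈ R, f (ω.translate t⁻¹) = 0}

theorem isClosed_spectrumOf (R : Set C(XG G, ℂ)) : IsClosed (spectrumOf R) := by
  have h : spectrumOf R = ⋂ t : G, ⋂ f ∈ R, {ω | (canonicalAction G).alpha t f ω = 0} := by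
    ext ω
    simp only [Set.mem_iInter, Set.mem_ofPred_eq]
    constructor
    · intro hω t f hf
      by_cases ht : ω ∈ (canonicalAction G).dom t
      · rw [PartialAction.alpha_apply_mem _ ht]
        exact hω t ht f hf
      · exact PartialAction.alpha_apply_notMem _ ht f
    · intro hω t ht f hf
      have := hω t f hf
      rwa [PartialAction.alpha_apply_mem _ (show ω ∈ (canonicalAction G).dom t from ht)] at this
  rw [h]
  exact isClosed_iInter fun t => isClosed_biInter fun f _ =>
    isClosed_eq (map_continuous _) continuous_const

instance (R : Set C(XG G, ℂ)) : CompactSpace (spectrumOf R) :=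
  isCompact_iff_compactSpace.1 (isClosed_spectrumOf R).isCompact

theorem spectrumOf_invariant (R : Set C(XG G, ℂ)) (t : G) :
    ∀ ω ∈ spectrumOf R, ω ∈ (canonicalAction G).dom t⁻¹ →
      (canonicalAction G).act t ω ∈ spectrumOf R := by
  intro ω hω ht s hs f hf
  have ht' : ω.1 t⁻¹ = true := ht
  have hs' : (ω.translate t).1 s = true := hs
  have h := XG.translate_translate (s := s⁻¹) ht' (by rwa [inv_inv])
  have h1 : ω.1 (t⁻¹ * s) = true := by rwa [XG.translate_apply ht'] at hs'
  have := hω (t⁻¹ * s) h1 f hf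
  rw [mul_inv_rev, inv_inv, h.2] at this
  exact this

/-- The partial action of `G` on the spectrum `Ω_R`, by restriction of the canonical one. -/
def spectrumAction (R : Set C(XG G, ℂ)) : PartialAction G (spectrumOf R) :=
  (canonicalAction G).restrict (spectrumOf R) (spectrumOf_invariant R)

end Spectrum

/-! ### Partial representations and covariant representations -/

/-- A partial representation of the group `G` on the Hilbert space `H`. -/
@[ext]
structure PartialRep (G : Type u) [Group G] (H : Type w) [NormedAddCommGroup H]
    [InnerProductSpace ℂ H] [CompleteSpace H] where
  toFun : G → H →L[ℂ] H
  map_one : toFun 1 = 1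
  map_inv : ∀ t, toFun t⁻¹ = star (toFun t)
  map_mul : ∀ s t, toFun s * toFun t * toFun t⁻¹ = toFun (s * t) * toFun t⁻¹

instance {G : Type u} [Group G] {H : Type w} [NormedAddCommGroup H]
    [InnerProductSpace ℂ H] [CompleteSpace H] :
    CoeFun (PartialRep G H) (fun _ => G → H →L[ℂ] H) := ⟨PartialRep.toFun⟩

section Representations

variable {G : Type u} [Group G] {H : Type w} [NormedAddCommGroup H]
  [InnerProductSpace ℂ H] [CompleteSpace H]

/-- For a representation `π` of `A` on `H` and `I ⊆ A`: the closed linear span of `π(I)H`. -/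
def essentialSubspace {A : Type v} [NonUnitalNonAssocSemiring A] [Module ℂ A] [Star A]
    (π : A →⋆ₙₐ[ℂ] (H →L[ℂ] H)) (I : Set A) : Submodule ℂ H :=
  (Submodule.span ℂ {η | ∃ a ∈ I, ∃ ξ : H, π a ξ = η}).topologicalClosure

/-- A representation `π` of `A` on `H` is nondegenerate if `π(A)H` spans a dense subspace. -/
def IsNondegenerate {A : Type v} [NonUnitalNonAssocSemiring A] [Module ℂ A] [Star A]
    (π : A →⋆ₙₐ[ℂ] (H →L[ℂ] H)) : Prop :=
  essentialSubspace π Set.univ = ⊤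

instance {A : Type v} [NonUnitalNonAssocSemiring A] [Module ℂ A] [Star A]
    (π : A →⋆ₙₐ[ℂ] (H →L[ℂ] H)) (I : Set A) : CompleteSpace (essentialSubspace π I) :=
  (Submodule.isClosed_topologicalClosure _).completeSpace_coe

/-- `(π, V)` is a covariant representation on `H` of the partial dynamical system
`(C(X), G, α)` given by `θ`. -/
structure IsCovariant {X : Type v} [TopologicalSpace X] (θ : PartialAction G X)
    (π : C(X, ℂ) →⋆ₙₐ[ℂ] (H →L[ℂ] H)) (V : PartialRep G H) : Prop where
  nondegenerate : IsNondegenerate π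
  range_proj : ∀ t, V t * star (V t) = (essentialSubspace π (θ.ideal t)).starProjection
  covariance : ∀ t, ∀ a ∈ θ.ideal t⁻¹, π (θ.alpha t a) = V t * π a * V t⁻¹

/-- `σ` is the representation `π × V` of the crossed product:
`(π × V)(a δ_t) = π(a) V_t` for `a ∈ D_t`. -/
def IsIntegratedForm {X : Type v} [TopologicalSpace X] [CompactSpace X] (θ : PartialAction G X)
    (π : C(X, ℂ) →⋆ₙₐ[ℂ] (H →L[ℂ] H)) (V : PartialRep G H)
    (σ : θ.CrossedProduct →⋆ₙₐ[ℂ] (H →L[ℂ] H)) : Prop :=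
  ∀ t (a : θ.ideal t), σ (PartialAction.CrossedProduct.delta θ t a) = π a * V t

namespace PartialRep

variable (V : PartialRep G H)

/-- The range projection `e(t) = V_t V_t^*`. -/
def rangeProj (t : G) : H →L[ℂ] H := V t * star (V t)

theorem rangeProj_eq (t : G) : V.rangeProj t = V t * V t⁻¹ := by rw [rangeProj, V.map_inv]

theorem mul_inv_mul (t : G) : V t * V t⁻¹ * V t = V t := by
  have := V.map_mul t t⁻¹
  rwa [inv_inv, mul_inv_cancel, V.map_one, one_mul] at this

theorem map_mul_left (s t : G) : V t⁻¹ * V t * V s = V t⁻¹ * V (t * s) := by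
  have := congrArg star (V.map_mul s⁻¹ t⁻¹)
  simp only [star_mul, ← V.map_inv, inv_inv, mul_inv_rev, mul_assoc] at this ⊢
  exact this

theorem mul_rangeProj (s t : G) : V s * V.rangeProj t = V.rangeProj (s * t) * V s := by
  have h2 := V.map_mul_left s (s * t)⁻¹
  rw [inv_inv, show (s * t)⁻¹ * s = t⁻¹ by group] at h2
  rw [rangeProj_eq, rangeProj_eq, ← mul_assoc, V.map_mul, h2]

theorem rangeProj_commute (s t : G) :
    V.rangeProj s * V.rangeProj t = V.rangeProj t * V.rangeProj s := by
  conv_lhs => rw [rangeProj_eq V s]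
  rw [mul_assoc, mul_rangeProj, ← mul_assoc, mul_rangeProj, mul_inv_cancel_left, mul_assoc,
    ← rangeProj_eq]

theorem rangeProj_mul_self (t : G) : V.rangeProj t * V.rangeProj t = V.rangeProj t := by
  rw [rangeProj_eq, ← mul_assoc, mul_inv_mul]

theorem star_rangeProj (t : G) : star (V.rangeProj t) = V.rangeProj t := by
  rw [rangeProj, star_mul, star_star]

/-- The commutative `C^*`-algebra generated by the range projections. -/
def rangeAlgebra : StarSubalgebra ℂ (H →L[ℂ] H) :=
  (StarAlgebra.adjoin ℂ (Set.range V.rangeProj)).topologicalClosure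

theorem rangeAlgebra_mul_comm (x y : V.rangeAlgebra) : x * y = y * x := by
  have : IsMulCommutative (StarAlgebra.adjoin ℂ (Set.range V.rangeProj)) :=
    StarAlgebra.isMulCommutative_adjoin ℂ
      (by rintro _ ⟨s, rfl⟩ _ ⟨t, rfl⟩; exact V.rangeProj_commute s t)
      (by rintro _ ⟨s, rfl⟩ _ ⟨t, rfl⟩; rw [star_rangeProj]; exact V.rangeProj_commute s t)
  exact (StarSubalgebra.commRingTopologicalClosure
    (StarAlgebra.adjoin ℂ (Set.range V.rangeProj)) (fun a b => this.is_comm.comm a b)).mul_comm x y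

instance : IsClosed (V.rangeAlgebra : Set (H →L[ℂ] H)) :=
  StarSubalgebra.isClosed_topologicalClosure _

instance : CommCStarAlgebra V.rangeAlgebra where
  __ := (StarSubalgebra.cstarAlgebra (S := StarSubalgebra ℂ (H →L[ℂ] H)) V.rangeAlgebra)
  mul_comm := V.rangeAlgebra_mul_comm

/-- The range projection as an element of `rangeAlgebra`. -/
def rangeElem (t : G) : V.rangeAlgebra :=
  ⟨V.rangeProj t, StarSubalgebra.le_topologicalClosure _ (StarAlgebra.subset_adjoin ℂ _ ⟨t, rfl⟩)⟩

theorem rangeElem_mul_self (t : G) : V.rangeElem t * V.rangeElem t = V.rangeElem t :=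
  Subtype.ext (V.rangeProj_mul_self t)

theorem rangeElem_one : V.rangeElem 1 = 1 :=
  Subtype.ext (by change V.rangeProj 1 = 1; simp [rangeProj, V.map_one])

open WeakDual in
theorem character_rangeElem (φ : characterSpace ℂ V.rangeAlgebra) (t : G) :
    φ (V.rangeElem t) = 0 ∨ φ (V.rangeElem t) = 1 := by
  have h : φ (V.rangeElem t) * φ (V.rangeElem t) = φ (V.rangeElem t) := by
    rw [← _root_.map_mul, rangeElem_mul_self]
  exact IsIdempotentElem.iff_eq_zero_or_one.1 h

open Classical WeakDual in
/-- The point `{t : φ(e(t)) = 1}` of `X_G` given by a character `φ`. -/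
def characterPoint : C(characterSpace ℂ V.rangeAlgebra, XG G) where
  toFun φ := ⟨fun t => decide (φ (V.rangeElem t) = 1), by simp [rangeElem_one]⟩
  continuous_toFun := by
    refine Continuous.subtype_mk (continuous_pi fun t => ?_) _
    have hc : Continuous fun φ : characterSpace ℂ V.rangeAlgebra => φ (V.rangeElem t) :=
      (WeakDual.eval_continuous (V.rangeElem t)).comp continuous_subtype_val
    refine continuous_bool_rng true |>.2 ?_
    constructor
    · convert isClosed_singleton.preimage hc (t := {(1 : ℂ)}) using 1
      ext φ; simp
    · convert (isClosed_singleton.preimage hc (t := {(0 : ℂ)})).isOpen_compl using 1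
      ext φ
      rcases V.character_rangeElem φ t with h | h <;> simp [h]

theorem exists_rho : ∃ ρ : C(XG G, ℂ) →⋆ₐ[ℂ] (H →L[ℂ] H),
    ∀ t, ρ ((canonicalAction G).char t) = V t * star (V t) := by
  refine ⟨V.rangeAlgebra.subtype.comp
    (((gelfandStarTransform V.rangeAlgebra).symm : _ →⋆ₐ[ℂ] V.rangeAlgebra).comp
      (ContinuousMap.compStarAlgHom' ℂ ℂ V.characterPoint)), fun t => ?_⟩
  have : ContinuousMap.compStarAlgHom' ℂ ℂ V.characterPoint ((canonicalAction G).char t)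
      = gelfandStarTransform V.rangeAlgebra (V.rangeElem t) := by
    ext φ
    rcases V.character_rangeElem φ t with h | h
    · simp [PartialAction.char, canonicalAction, characterPoint, h]
    · simp [PartialAction.char, canonicalAction, characterPoint, h]
  simp [this]
  rfl

open scoped CStarAlgebra in
/-- Every partial representation `V` determines a unique representation `ρ_V` of `C(X_G)` with
`ρ_V(1_t) = V_t V_t^*`. -/
theorem existsUnique_rho : ∃! ρ : C(XG G, ℂ) →⋆ₙₐ[ℂ] (H →L[ℂ] H),
    ∀ t, ρ ((canonicalAction G).char t) = V t * star (V t) := by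
  obtain ⟨ρ, hρ⟩ := V.exists_rho
  refine ⟨ρ, hρ, ?_⟩
  intro ρ' hρ'
  have h1 : (canonicalAction G).char 1 = 1 := by
    ext ω
    simp [PartialAction.char, (canonicalAction G).dom_one]
  have h2 : ρ' 1 = 1 := by rw [← h1, hρ', V.map_one, star_one, one_mul]
  let ρ₁ : C(XG G, ℂ) →⋆ₐ[ℂ] (H →L[ℂ] H) :=
    { ρ' with
      map_one' := h2
      commutes' := fun c => by
        change ρ' (algebraMap ℂ _ c) = _
        rw [Algebra.algebraMap_eq_smul_one, Algebra.algebraMap_eq_smul_one, map_smul, h2] }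
  have hρ₁ : ∀ f, ρ₁ f = ρ' f := fun _ => rfl
  let S : StarSubalgebra ℂ C(XG G, ℂ) := StarAlgHom.equalizer ρ ρ₁
  have hS : S.topologicalClosure = ⊤ := by
    refine ContinuousMap.starSubalgebra_topologicalClosure_eq_top_of_separatesPoints S ?_
    intro ω ω' hne
    obtain ⟨t, ht⟩ : ∃ t, ω.1 t ≠ ω'.1 t := by
      by_contra! h
      exact hne (Subtype.ext (funext h))
    refine ⟨_, ⟨(canonicalAction G).char t, ?_, rfl⟩, ?_⟩
    · change ρ _ = ρ₁ _
      rw [hρ, hρ₁, hρ']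
    · cases h : ω.1 t <;> cases h' : ω'.1 t <;>
        simp_all [PartialAction.char, canonicalAction]
  have hclosed : IsClosed (S : Set C(XG G, ℂ)) :=
    isClosed_eq (map_continuous ρ) (map_continuous ρ₁)
  refine NonUnitalStarAlgHom.ext fun f => ?_
  have hf : f ∈ S.topologicalClosure := hS ▸ StarSubalgebra.mem_top
  have hf' : f ∈ closure (S : Set C(XG G, ℂ)) := hf
  rw [hclosed.closure_eq] at hf'
  exact (show ρ f = ρ₁ f from hf').symm

/-- The representation `ρ_V` of `C(X_G)` obtained by extending the map `1_t ↦ V_t V_t^*`. -/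
def rho : C(XG G, ℂ) →⋆ₙₐ[ℂ] (H →L[ℂ] H) := V.existsUnique_rho.choose

theorem rho_char (t : G) : V.rho ((canonicalAction G).char t) = V t * star (V t) :=
  V.existsUnique_rho.choose_spec.1 t

/-- `V` satisfies the relations `R ⊆ C(X_G)`: the representation `ρ_V` vanishes on `R`. -/
def Satisfies (R : Set C(XG G, ℂ)) : Prop := ∀ f ∈ R, V.rho f = 0

/-- The `C^*`-algebra `C^*({V_t : t ∈ G})` generated by a partial representation
(it contains the identity operator `V_1`). -/
def cStar : StarSubalgebra ℂ (H →L[ℂ] H) :=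
  (StarAlgebra.adjoin ℂ (Set.range V)).topologicalClosure

theorem mem_cStar (t : G) : V t ∈ V.cStar :=
  StarSubalgebra.le_topologicalClosure _ (StarAlgebra.subset_adjoin ℂ _ ⟨t, rfl⟩)

/-- `V_t` as an element of `C^*({V_t : t ∈ G})`. -/
def gen (t : G) : V.cStar := ⟨V t, V.mem_cStar t⟩

end PartialRep
end Representations

/-- The partial representation `v` of `G` on `K` is universal for the relations `R` (with respect
to the partial representations on Hilbert spaces of the universe `w`): it satisfies `R`, and for
every partial representation `V` satisfying `R` the map `v_t ↦ V_t` extends to a homomorphism of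
`C^*({v_t})` onto `C^*({V_t})`. The `C^*`-algebra `C^*_p(G; R)` is `v.cStar` for universal `v`. -/
def IsUniversal.{a, b, c} {G : Type a} [Group G] (R : Set C(XG G, ℂ)) {K : Type b}
    [NormedAddCommGroup K] [InnerProductSpace ℂ K] [CompleteSpace K] (v : PartialRep G K) : Prop :=
  v.Satisfies R ∧
  ∀ (H : Type c) [NormedAddCommGroup H] [InnerProductSpace ℂ H] [CompleteSpace H]
    (V : PartialRep G H), V.Satisfies R →
      ∃ φ : v.cStar →⋆ₐ[ℂ] V.cStar, Function.Surjective φ ∧ ∀ t, φ (v.gen t) = V.gen t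

end

/-! ### Faithful representations and closed ranges -/

section FaithfulRepresentation

open scoped ComplexOrder ComplexStarModule ENNReal

/-! Every domain X_t is clopen, so D_t has the unit 1_t and analytic conditions turn into algebra:
the projection onto the closed span of ρ(D_t)H is ρ(1_t), and a δ_t = (a δ_e)(1_t δ_t). A
nondegenerate representation of the crossed product is unital, hence amounts to its restriction to
C(Ω_R) together with the partial representation formed by the images of the 1_t δ_t. Conversely a
covariant pair gives a *-homomorphism of the convolution algebra into B(H). Its norm is a
C*-seminorm below the ℓ¹-norm, since partial isometries and representations are contractive, so it
extends to the completion.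

The relations enter through the identity ρ_V(α_t(f)) = V_t ρ_V(f) V_t^* (`rho_alpha`). It makes the
kernel of ρ_V an invariant closed ideal of C(X_G), that is, the functions vanishing on some closed
set. If the kernel contains R, then by invariance it contains every α_t(f) with f in R, which forces
this closed set into Ω_R. Hence ρ_V factors through C(Ω_R) (`Satisfies.rho_eq_zero`,
`Satisfies.exists_factor`). In the other direction, functions in R vanish on Ω_R, and uniqueness of
ρ_V identifies it with ρ composed with restriction.

Uniqueness rests on Stone–Weierstrass: the sets X_t separate points, so the 1_t generate C(Ω_R), and
the 1_t δ_t generate the crossed product. For part (iii), a faithful representation of the crossed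
product (Gelfand–Naimark) yields a V with C*({V_t}) isomorphic to the crossed product. Any W
satisfying R integrates to a map of the crossed product onto C*({W_t}), ranges of *-homomorphisms
being closed, so V is universal. For an arbitrary universal v, the map onto C*({v_t}) is injective
because universality lets it be followed by a map whose composite is faithful. -/

/-- Positive linear functionals separate the nonzero positive elements from `0`. -/
theorem exists_positiveLinearMap_ne_zero {A : Type u} [CStarAlgebra A] [PartialOrder A]
    [StarOrderedRing A] {b : A} (hb : 0 ≤ b) (hb0 : b ≠ 0) : ∃ f : A →ₚ[ℂ] ℂ, f b ≠ 0 := by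
  have hneg : -b ∉ ProperCone.positive ℝ A := by
    intro h
    rw [ProperCone.mem_positive, neg_nonneg] at h
    exact hb0 (le_antisymm h hb)
  -- Hahn–Banach separates -b from the closed positive cone; the resulting real functional g is
  -- positive and satisfies g(-b) < 0. The map `f` is its complex-linear extension from the
  -- self-adjoint part.
  obtain ⟨g, hg, hgb⟩ := ProperCone.hyperplane_separation_point _ hneg
  let f : A →ₗ[ℂ] ℂ :=
    { toFun x := g (ℜ x : A) + Complex.I * g (ℑ x : A)
      map_add' x y := by
        simp only [map_add, AddSubgroup.coe_add, Complex.ofReal_add, mul_add]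
        ring
      map_smul' c x := by
        simp only [realPart_smul, imaginaryPart_smul, AddSubgroupClass.coe_sub, AddSubgroup.coe_add,
          selfAdjoint.val_smul, map_sub, map_add, map_smul, smul_eq_mul, RingHom.id_apply]
        apply Complex.ext <;> simp }
  have hf : ∀ x : A, IsSelfAdjoint x → f x = g x := by
    intro x hx
    change (g (ℜ x : A) : ℂ) + Complex.I * g (ℑ x : A) = g x
    rw [hx.imaginaryPart, hx.coe_realPart]
    simp
  refine ⟨PositiveLinearMap.mk₀ f fun x hx => ?_, ?_⟩
  · rw [hf x (IsSelfAdjoint.of_nonneg hx)]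
    exact_mod_cast hg x hx
  · change f b ≠ 0
    rw [hf b (IsSelfAdjoint.of_nonneg hb)]
    rw [map_neg] at hgb
    exact_mod_cast (by linarith : 0 < g b).ne'

/-- The direct sum of a uniformly bounded family of operators on Hilbert spaces. -/
noncomputable def l2DirectSum {ι : Type v} {E : ι → Type w} [∀ i, NormedAddCommGroup (E i)]
    [∀ i, InnerProductSpace ℂ (E i)] (T : ∀ i, E i →L[ℂ] E i) (C : ℝ)
    (hT : ∀ i, ‖T i‖ ≤ C) : lp E 2 →L[ℂ] lp E 2 :=
  -- Comparing with the vector C • x gives square-summability and the operator bound at once. The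
  -- bound uses ‖C‖ because an empty family does not force C ≥ 0.
  have hbound (x : lp E 2) (i : ι) : ‖T i (x i)‖ ≤ ‖((C : ℂ) • x) i‖ := by
    have hC : ‖(C : ℂ)‖ = C := by
      rw [Complex.norm_real, Real.norm_of_nonneg ((norm_nonneg _).trans (hT i))]
    rw [lp.coeFn_smul, Pi.smul_apply, norm_smul, hC]
    exact (T i).le_of_opNorm_le (hT i) _
  LinearMap.mkContinuous
    { toFun x := ⟨fun i => T i (x i), (lp.memℓp ((C : ℂ) • x)).mono' (hbound x)⟩
      map_add' x y := by ext i; exact map_add (T i) _ _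
      map_smul' c x := by ext i; exact map_smul (T i) c _ } ‖(C : ℂ)‖ fun x => by
    rw [← norm_smul]
    exact lp.norm_mono two_ne_zero (hbound x)

theorem l2DirectSum_apply {ι : Type v} {E : ι → Type w} [∀ i, NormedAddCommGroup (E i)]
    [∀ i, InnerProductSpace ℂ (E i)] (T : ∀ i, E i →L[ℂ] E i) (C : ℝ)
    (hT : ∀ i, ‖T i‖ ≤ C) (x : lp E 2) (i : ι) : l2DirectSum T C hT x i = T i (x i) := rfl

open scoped InnerProductSpace in
/-- The direct sum of a family of representations. -/
noncomputable def directSumRep {A : Type u} [CStarAlgebra A] {ι : Type v} {E : ι → Type w}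
    [∀ i, NormedAddCommGroup (E i)] [∀ i, InnerProductSpace ℂ (E i)] [∀ i, CompleteSpace (E i)]
    (π : ∀ i, A →⋆ₐ[ℂ] (E i →L[ℂ] E i)) : A →⋆ₐ[ℂ] (lp E 2 →L[ℂ] lp E 2) where
  toFun a := l2DirectSum (fun i => π i a) ‖a‖ fun i => NonUnitalStarAlgHom.norm_apply_le (π i) a
  map_one' := by ext x i; simp [l2DirectSum_apply]
  map_mul' a b := by ext x i; simp [l2DirectSum_apply]
  map_zero' := by ext x i; simp [l2DirectSum_apply]
  map_add' a b := by ext x i; simp [l2DirectSum_apply]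
  commutes' c := by ext x i; simp [l2DirectSum_apply, Algebra.algebraMap_eq_smul_one]
  map_star' a := by
    rw [ContinuousLinearMap.star_eq_adjoint, ContinuousLinearMap.eq_adjoint_iff]
    intro x y
    rw [lp.inner_eq_tsum, lp.inner_eq_tsum]
    refine tsum_congr fun i => ?_
    rw [l2DirectSum_apply, l2DirectSum_apply, map_star, ContinuousLinearMap.star_eq_adjoint,
      ContinuousLinearMap.adjoint_inner_left]

theorem directSumRep_apply {A : Type u} [CStarAlgebra A] {ι : Type v} {E : ι → Type w}
    [∀ i, NormedAddCommGroup (E i)] [∀ i, InnerProductSpace ℂ (E i)] [∀ i, CompleteSpace (E i)]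
    (π : ∀ i, A →⋆ₐ[ℂ] (E i →L[ℂ] E i)) (a : A) (x : lp E 2) (i : ι) :
    directSumRep π a x i = π i a (x i) := rfl

/-- Choose f with f(a^*a) ≠ 0. In its GNS space, a moves the class of 1 to a vector whose squared
norm is f(a^*a). -/
theorem exists_gnsStarAlgHom_ne_zero {A : Type u} [CStarAlgebra A] [PartialOrder A]
    [StarOrderedRing A] {a : A} (ha : a ≠ 0) : ∃ f : A →ₚ[ℂ] ℂ, f.gnsStarAlgHom a ≠ 0 := by
  obtain ⟨f, hf⟩ := exists_positiveLinearMap_ne_zero (star_mul_self_nonneg a)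
    ((CStarRing.star_mul_self_ne_zero_iff a).2 ha)
  refine ⟨f, fun h => hf ?_⟩
  have h1 := congrArg (fun T => T (f.toPreGNS 1 : f.GNS)) h
  change f.gnsNonUnitalStarAlgHom a (f.toPreGNS 1 : f.GNS) = 0 at h1
  rw [PositiveLinearMap.gnsNonUnitalStarAlgHom_apply_coe] at h1
  have h2 := congrArg norm h1
  rw [UniformSpace.Completion.norm_coe, norm_zero] at h2
  have h3 := f.preGNS_norm_sq (f.leftMulMapPreGNS a (f.toPreGNS 1))
  rw [h2] at h3
  simpa using h3.symm

/-- **Gelfand–Naimark**: every `C^*`-algebra has a faithful representation on a Hilbert space. -/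
theorem exists_faithful_representation (A : Type u) [CStarAlgebra A] :
    ∃ (H : Type (max u w)) (_ : NormedAddCommGroup H) (_ : InnerProductSpace ℂ H)
      (_ : CompleteSpace H) (π : A →⋆ₐ[ℂ] (H →L[ℂ] H)), Function.Injective π := by
  classical
  let _ : PartialOrder A := CStarAlgebra.spectralOrder A
  have : StarOrderedRing A := CStarAlgebra.spectralOrderedRing A
  -- The sum runs over all positive functionals; `ULift` only raises the universe of the Hilbert
  -- space so that it reaches any prescribed `w`.
  let E : ULift.{w} (A →ₚ[ℂ] ℂ) → Type u := fun f => f.down.GNS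
  refine ⟨lp E 2, inferInstance, inferInstance, inferInstance,
    directSumRep fun f => f.down.gnsStarAlgHom, ?_⟩
  rw [injective_iff_map_eq_zero]
  intro a ha
  by_contra h
  obtain ⟨f, hf⟩ := exists_gnsStarAlgHom_ne_zero h
  refine hf (ContinuousLinearMap.ext fun ξ => ?_)
  -- Test on vectors concentrated in the summand of f, which recovers the GNS representation of f.
  have h1 := congrArg (fun T => T (lp.single 2 (⟨f⟩ : ULift.{w} (A →ₚ[ℂ] ℂ)) ξ : lp E 2) ⟨f⟩) ha
  rw [directSumRep_apply, lp.single_apply_self] at h1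
  exact h1

end FaithfulRepresentation

/-! ### Closed ranges of homomorphisms of C*-algebras -/

section ClosedRange

open scoped ComplexStarModule CStarAlgebra

variable {A : Type u} {B : Type v} [CStarAlgebra A] [CStarAlgebra B]

/-- Truncate a by functional calculus to the interval [-‖φ a‖, ‖φ a‖]. Since φ commutes with the
calculus and the truncation is the identity on the spectrum of φ(a), the image does not change. -/
theorem StarAlgHom.exists_selfAdjoint_preimage_norm_le (φ : A →⋆ₐ[ℂ] B) {a : A}
    (ha : IsSelfAdjoint a) : ∃ a', φ a' = φ a ∧ ‖a'‖ ≤ ‖φ a‖ := by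
  have hc : Continuous fun x : ℝ => max (-‖φ a‖) (min x ‖φ a‖) := by fun_prop
  refine ⟨cfc (fun x : ℝ => max (-‖φ a‖) (min x ‖φ a‖)) a, ?_, ?_⟩
  · rw [StarAlgHomClass.map_cfc φ _ a hc.continuousOn (map_continuous φ) ha (ha.map φ)]
    conv_rhs => rw [← cfc_id ℝ (φ a) (ha.map φ)]
    refine cfc_congr fun x hx => ?_
    -- The spectral bound needs ‖1‖ = 1 in B; in the zero algebra the spectrum is empty and there is
    -- no point x.
    have : Nontrivial B := by
      by_contra h
      rw [not_nontrivial_iff_subsingleton] at h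
      simp [spectrum.of_subsingleton] at hx
    have h1 := spectrum.norm_le_norm_of_mem hx
    rw [Real.norm_eq_abs, abs_le] at h1
    simp [h1.1, h1.2]
  · refine norm_cfc_le (norm_nonneg _) fun x _ => ?_
    rw [Real.norm_eq_abs, abs_le]
    have := norm_nonneg (φ a)
    exact ⟨le_max_left _ _, max_le (by linarith) (min_le_right _ _)⟩

/-- Truncate real and imaginary parts separately; the factor 2 is the sum of the two bounds. -/
theorem StarAlgHom.exists_preimage_norm_le (φ : A →⋆ₐ[ℂ] B) (a : A) :
    ∃ a', φ a' = φ a ∧ ‖a'‖ ≤ 2 * ‖φ a‖ := by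
  obtain ⟨x, hx, hx'⟩ := φ.exists_selfAdjoint_preimage_norm_le (ℜ a).2
  obtain ⟨y, hy, hy'⟩ := φ.exists_selfAdjoint_preimage_norm_le (ℑ a).2
  have e1 : φ (ℜ a : A) = (ℜ (φ a) : B) :=
    map_realPart φ a
  have e2 : φ (ℑ a : A) = (ℑ (φ a) : B) :=
    map_imaginaryPart φ a
  refine ⟨x + Complex.I • y, ?_, ?_⟩
  · rw [map_add, map_smul, hx, hy, ← map_smul, ← map_add, realPart_add_I_smul_imaginaryPart]
  · refine (norm_add_le _ _).trans ?_
    rw [norm_smul, Complex.norm_I, one_mul, two_mul]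
    refine add_le_add (hx'.trans ?_) (hy'.trans ?_)
    · rw [e1]; exact realPart.norm_le (φ a)
    · rw [e2]; exact imaginaryPart.norm_le (φ a)

/-- The range of a homomorphism between `C^*`-algebras is closed. -/
theorem StarAlgHom.isClosed_range (φ : A →⋆ₐ[ℂ] B) : IsClosed (Set.range φ) := by
  let f : NormedAddGroupHom A B :=
    AddMonoidHom.mkNormedAddGroupHom (φ : A →+ B) 1 fun a => by
      simpa using NonUnitalStarAlgHom.norm_apply_le φ a
  have hf : ∀ a, f a = φ a := fun _ => rfl
  -- Preimages controlled by the factor 2, summed along a series in the complete space A, give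
  -- preimages for limit points of the range. The value of ε is immaterial.
  have h := controlled_closure_of_complete (f := f) (K := f.range) (C := 2) (ε := 1)
    (by norm_num) (by norm_num) (by
      rintro _ ⟨a, rfl⟩
      exact φ.exists_preimage_norm_le a)
  refine isClosed_of_closure_subset fun b hb => ?_
  obtain ⟨a, ha, -⟩ := h b hb
  exact ⟨a, ha⟩

end ClosedRange

/-! ### Representations of crossed products -/

section NondegenerateRepresentations

variable {H : Type w} [NormedAddCommGroup H] [InnerProductSpace ℂ H] [CompleteSpace H]

/-- The operator π(1) fixes every vector π(a)ζ, and its fixed vectors form a closed subspace. -/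
theorem IsNondegenerate.map_one {A : Type v} [Semiring A] [Module ℂ A] [Star A]
    {π : A →⋆ₙₐ[ℂ] (H →L[ℂ] H)} (h : IsNondegenerate π) : π 1 = 1 := by
  ext ξ
  have hξ : ξ ∈ essentialSubspace π Set.univ := h ▸ Submodule.mem_top
  refine closure_minimal (s := (Submodule.span ℂ {η | ∃ a ∈ (Set.univ : Set A), ∃ ξ : H, π a ξ = η} :
    Set H)) (t := {ξ | π 1 ξ = (1 : H →L[ℂ] H) ξ}) ?_
    (isClosed_eq (π 1).continuous (1 : H →L[ℂ] H).continuous) hξ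
  intro η hη
  induction hη using Submodule.span_induction with
  | mem η hη =>
    obtain ⟨a, -, ζ, rfl⟩ := hη
    change (π 1 * π a) ζ = π a ζ
    rw [← map_mul, one_mul]
  | zero => simp
  | add x y _ _ hx hy => simp_all
  | smul c x _ hx => simp_all

theorem isNondegenerate_of_map_one {A : Type v} [Semiring A] [Module ℂ A] [Star A]
    {π : A →⋆ₙₐ[ℂ] (H →L[ℂ] H)} (h : π 1 = 1) : IsNondegenerate π := by
  refine eq_top_iff.2 fun ξ _ => Submodule.le_topologicalClosure _ (Submodule.subset_span ?_)
  exact ⟨1, Set.mem_univ _, ξ, by rw [h]; rfl⟩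

/-- A nondegenerate representation of a unital algebra as a unital homomorphism. -/
def NonUnitalStarAlgHom.toStarAlgHomOfMapOne {A : Type v} {B : Type w} [Semiring A] [Algebra ℂ A]
    [Star A] [Semiring B] [Algebra ℂ B] [Star B] (π : A →⋆ₙₐ[ℂ] B) (h : π 1 = 1) :
    A →⋆ₐ[ℂ] B :=
  { π with
    map_one' := h
    commutes' := fun c => by
      change π (algebraMap ℂ _ c) = _
      rw [Algebra.algebraMap_eq_smul_one, Algebra.algebraMap_eq_smul_one, map_smul, h] }

end NondegenerateRepresentations

namespace PartialAction

variable {G : Type u} {X : Type v} [Group G] [TopologicalSpace X] (θ : PartialAction G X)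

theorem mem_ideal_one (a : C(X, ℂ)) : a ∈ θ.ideal 1 :=
  fun x hx => (hx (θ.dom_one ▸ Set.mem_univ x)).elim

theorem char_one : θ.char 1 = 1 := by
  ext x
  simp [char, θ.dom_one]

/-- This is θ_s(X_{s⁻¹} ∩ X_t) = X_s ∩ X_{st} in terms of characteristic functions. -/
theorem alpha_char (s t : G) : θ.alpha s (θ.char t) = θ.char s * θ.char (s * t) := by
  rw [← alpha_one_right, alpha_alpha, alpha_one_right]

/-! ### Stone–Weierstrass for the characteristic functions of the domains -/

section Separating

/-- The domains of a partial action separate the points of the space. -/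
def SeparatesPoints : Prop := ∀ x y : X, (∀ t, x ∈ θ.dom t ↔ y ∈ θ.dom t) → x = y

variable {θ} [CompactSpace X]

/-- If the domains separate points, then their characteristic functions generate `C(X)`. -/
theorem SeparatesPoints.induction (hθ : θ.SeparatesPoints) {P : C(X, ℂ) → Prop}
    (closed : IsClosed {f | P f}) (char : ∀ t, P (θ.char t)) (smul : ∀ (c : ℂ) f, P f → P (c • f))
    (add : ∀ f g, P f → P g → P (f + g)) (mul : ∀ f g, P f → P g → P (f * g))
    (star : ∀ f, P f → P (star f)) (f : C(X, ℂ)) : P f := by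
  have htop : (StarAlgebra.adjoin ℂ (Set.range θ.char)).topologicalClosure = ⊤ := by
    refine ContinuousMap.starSubalgebra_topologicalClosure_eq_top_of_separatesPoints _ ?_
    intro x y hne
    obtain ⟨t, ht⟩ : ∃ t, ¬(x ∈ θ.dom t ↔ y ∈ θ.dom t) := by
      by_contra! h
      exact hne (hθ x y h)
    refine ⟨_, ⟨θ.char t, StarAlgebra.subset_adjoin ℂ _ ⟨t, rfl⟩, rfl⟩, ?_⟩
    by_cases hx : x ∈ θ.dom t <;> by_cases hy : y ∈ θ.dom t <;>
      simp_all [PartialAction.char]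
  have hf : f ∈ closure (StarAlgebra.adjoin ℂ (Set.range θ.char) : Set C(X, ℂ)) := by
    change f ∈ (StarAlgebra.adjoin ℂ (Set.range θ.char)).topologicalClosure
    exact htop ▸ StarSubalgebra.mem_top
  refine closure_minimal (t := {f | P f}) (fun g hg => ?_) closed hf
  change P g
  induction hg using StarAlgebra.adjoin_induction with
  | mem g hg => obtain ⟨t, rfl⟩ := hg; exact char t
  -- Constants are multiples of 1_e = 1, so they need no hypothesis of their own.
  | algebraMap c =>
    rw [Algebra.algebraMap_eq_smul_one, ← θ.char_one]
    exact smul c _ (char 1)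
  | add x y _ _ hx hy => exact add x y hx hy
  | mul x y _ _ hx hy => exact mul x y hx hy
  | star x _ hx => exact star x hx

theorem SeparatesPoints.hom_ext (hθ : θ.SeparatesPoints) {B : Type w} [CStarAlgebra B]
    {φ ψ : C(X, ℂ) →⋆ₙₐ[ℂ] B} (h : ∀ t, φ (θ.char t) = ψ (θ.char t)) : φ = ψ := by
  open scoped CStarAlgebra in
  refine NonUnitalStarAlgHom.ext fun f => ?_
  induction f using hθ.induction with
  | closed => exact isClosed_eq (map_continuous φ) (map_continuous ψ)
  | char t => exact h t
  | smul c f hf => rw [map_smul, map_smul, hf]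
  | add f g hf hg => rw [map_add, map_add, hf, hg]
  | mul f g hf hg => rw [map_mul, map_mul, hf, hg]
  | star f hf => rw [map_star, map_star, hf]

theorem SeparatesPoints.map_mem (hθ : θ.SeparatesPoints) {B : Type w} [CStarAlgebra B]
    (φ : C(X, ℂ) →⋆ₙₐ[ℂ] B) (S : StarSubalgebra ℂ B) (hS : IsClosed (S : Set B))
    (h : ∀ t, φ (θ.char t) ∈ S) (f : C(X, ℂ)) : φ f ∈ S := by
  open scoped CStarAlgebra in
  induction f using hθ.induction with
  | closed => exact hS.preimage (map_continuous φ)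
  | char t => exact h t
  | smul c f hf => rw [map_smul]; exact S.smul_mem hf c
  | add f g hf hg => rw [map_add]; exact add_mem hf hg
  | mul f g hf hg => rw [map_mul]; exact mul_mem hf hg
  | star f hf => rw [map_star]; exact star_mem hf

end Separating

/-! ### Calculus of the elements a δ_t in the convolution algebra -/

namespace ConvAlgebra

variable {θ}

/-- The index and coefficient of the product enter through equations, which avoids transport between
the types `θ.ideal (t * s)` and `θ.ideal r`. -/
theorem delta_mul_delta {t s r : G} {a : θ.ideal t} {b : θ.ideal s} {c : θ.ideal r}
    (hr : t * s = r) (hc : a.1 * θ.alpha t b.1 = c.1) : delta θ t a * delta θ s b = delta θ r c := by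
  refine Subtype.ext ?_
  change θ.convMul (Finsupp.single t a.1) (Finsupp.single s b.1) = Finsupp.single r c.1
  rw [convMul_single, hr, hc]

theorem star_delta {t r : G} {a : θ.ideal t} {c : θ.ideal r}
    (hr : t⁻¹ = r) (hc : θ.alpha t⁻¹ (star a.1) = c.1) : star (delta θ t a) = delta θ r c := by
  refine Subtype.ext ?_
  change θ.convStar (Finsupp.single t a.1) = Finsupp.single r c.1
  rw [convStar_single, hc, hr]

theorem delta_add (t : G) (a b : θ.ideal t) : delta θ t (a + b) = delta θ t a + delta θ t b :=
  Subtype.ext (Finsupp.single_add t a.1 b.1)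

theorem delta_smul (t : G) (c : ℂ) (a b : θ.ideal t) (h : c • a.1 = b.1) :
    delta θ t b = c • delta θ t a := by
  refine Subtype.ext ?_
  change Finsupp.single t b.1 = c • Finsupp.single t a.1
  rw [← h, Finsupp.smul_single]

variable (θ) in
/-- The underlying finitely supported function, as a linear map. -/
noncomputable def coeffs : θ.ConvAlgebra →ₗ[ℂ] (G →₀ C(X, ℂ)) := θ.sections.subtype

theorem coeffs_delta (t : G) (a : θ.ideal t) :
    coeffs θ (delta θ t a) = Finsupp.single t a.1 := rfl

theorem eq_sum_delta (F : θ.ConvAlgebra) :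
    F = ∑ t ∈ (coeffs θ F).support, delta θ t ⟨coeffs θ F t, F.2 t⟩ := by
  refine Subtype.ext ?_
  change coeffs θ F = coeffs θ _
  rw [map_sum]
  exact (Finsupp.sum_single _).symm

@[elab_as_elim]
theorem induction {P : θ.ConvAlgebra → Prop} (zero : P 0) (delta : ∀ t a, P (delta θ t a))
    (add : ∀ F K, P F → P K → P (F + K)) (F : θ.ConvAlgebra) : P F := by
  rw [eq_sum_delta F]
  exact Finset.sum_induction _ P (fun _ _ => add _ _) zero fun t _ => delta t _

end ConvAlgebra

/-! ### The copy of C(X) and the partial isometries 1_t δ_t in the crossed product -/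

namespace CrossedProduct

variable [CompactSpace X] {θ}

theorem delta_mul_delta {t s r : G} {a : θ.ideal t} {b : θ.ideal s} {c : θ.ideal r}
    (hr : t * s = r) (hc : a.1 * θ.alpha t b.1 = c.1) : delta θ t a * delta θ s b = delta θ r c := by
  rw [delta, delta, ← of_mul, ConvAlgebra.delta_mul_delta hr hc, delta]

theorem star_delta {t r : G} {a : θ.ideal t} {c : θ.ideal r}
    (hr : t⁻¹ = r) (hc : θ.alpha t⁻¹ (star a.1) = c.1) : star (delta θ t a) = delta θ r c := by
  rw [delta, star_of, ConvAlgebra.star_delta hr hc, delta]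

theorem delta_one : delta θ 1 ⟨1, θ.mem_ideal_one 1⟩ = 1 := rfl

variable (θ) in
/-- The canonical embedding `a ↦ a δ_e` of `C(X)` into the crossed product. -/
noncomputable def incl : C(X, ℂ) →⋆ₙₐ[ℂ] θ.CrossedProduct where
  toFun a := delta θ 1 ⟨a, θ.mem_ideal_one a⟩
  map_smul' c a := by
    rw [delta, ConvAlgebra.delta_smul 1 c ⟨a, θ.mem_ideal_one a⟩ _ rfl, of_smul]
    rfl
  map_zero' := by
    have h : ConvAlgebra.delta θ 1 ⟨0, θ.mem_ideal_one 0⟩ = 0 := Subtype.ext (Finsupp.single_zero 1)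
    rw [delta, h]
    rfl
  map_add' a b := by
    rw [delta, delta, delta, ← of_add, ← ConvAlgebra.delta_add]
    rfl
  map_mul' a b := (delta_mul_delta (mul_one 1) (by rw [alpha_one])).symm
  map_star' a := (star_delta inv_one (by rw [inv_one, alpha_one])).symm

theorem incl_apply (a : C(X, ℂ)) : incl θ a = delta θ 1 ⟨a, θ.mem_ideal_one a⟩ := rfl

theorem incl_one : incl θ 1 = 1 := rfl

/-- This factorization is what reduces a representation of the crossed product to a pair (π, V). -/
theorem incl_mul_partialIsometry {t : G} (a : θ.ideal t) :
    incl θ a.1 * partialIsometry θ t = delta θ t a :=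
  delta_mul_delta (one_mul t) (by rw [alpha_one, θ.mul_char a.2])

theorem partialIsometry_one : partialIsometry θ 1 = 1 := by
  have h : (⟨θ.char 1, θ.char_mem_ideal 1⟩ : θ.ideal 1) = ⟨1, θ.mem_ideal_one 1⟩ :=
    Subtype.ext θ.char_one
  rw [partialIsometry, h, delta_one]

theorem partialIsometry_inv (t : G) : partialIsometry θ t⁻¹ = star (partialIsometry θ t) := by
  refine (star_delta rfl ?_).symm
  simp [char_star, alpha_char, char_one]

theorem partialIsometry_mul (s t : G) : partialIsometry θ s * partialIsometry θ t =
    delta θ (s * t) ⟨θ.char s * θ.char (s * t), (θ.ideal _).mul_mem_left _ (θ.char_mem_ideal _)⟩ :=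
  delta_mul_delta rfl (by rw [alpha_char, ← mul_assoc, char_mul_char])

/-- Both sides equal 1_s 1_{st} δ_s. -/
theorem partialIsometry_mul_mul_inv (s t : G) :
    partialIsometry θ s * partialIsometry θ t * partialIsometry θ t⁻¹ =
      partialIsometry θ (s * t) * partialIsometry θ t⁻¹ := by
  have hs : s * t * t⁻¹ = s := mul_inv_cancel_right s t
  rw [partialIsometry_mul,
    partialIsometry, delta_mul_delta (c := ⟨θ.char s * θ.char (s * t),
      (θ.ideal _).mul_mem_right _ (θ.char_mem_ideal _)⟩) hs,
    partialIsometry, delta_mul_delta (c := ⟨θ.char s * θ.char (s * t),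
      (θ.ideal _).mul_mem_right _ (θ.char_mem_ideal _)⟩) hs]
  · rw [alpha_char, hs, ← mul_assoc, char_mul_char, mul_comm]
  · rw [alpha_char, hs]
    calc _ = (θ.char s * θ.char s) * (θ.char (s * t) * θ.char (s * t)) := by ring
      _ = _ := by rw [char_mul_char, char_mul_char]

theorem partialIsometry_mul_star (t : G) :
    partialIsometry θ t * star (partialIsometry θ t) = incl θ (θ.char t) := by
  rw [← partialIsometry_inv]
  refine delta_mul_delta (mul_inv_cancel t) ?_
  rw [alpha_char, mul_inv_cancel, char_one, mul_one, char_mul_char]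

/-- Covariance already holds inside the crossed product, and for all of C(X), because `θ.alpha`
contains the cut-off by 1_{t⁻¹}. -/
theorem incl_alpha (t : G) (a : C(X, ℂ)) : incl θ (θ.alpha t a)
    = partialIsometry θ t * incl θ a * partialIsometry θ t⁻¹ := by
  rw [incl_apply, incl_apply, partialIsometry,
    delta_mul_delta (c := ⟨θ.alpha t a, θ.alpha_mem_ideal t a⟩) (mul_one t) (by rw [char_mul_alpha])]
  refine (delta_mul_delta (mul_inv_cancel t) ?_).symm
  rw [alpha_char, mul_inv_cancel, char_one, mul_one, mul_comm, char_mul_alpha]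

open scoped CStarAlgebra in
theorem hom_ext {B : Type w} [CStarAlgebra B] {σ τ : θ.CrossedProduct →⋆ₙₐ[ℂ] B}
    (h : ∀ t a, σ (delta θ t a) = τ (delta θ t a)) : σ = τ := by
  refine NonUnitalStarAlgHom.ext fun x => ?_
  induction x using induction_of with
  | hc => exact isClosed_eq (map_continuous σ) (map_continuous τ)
  | h F =>
    induction F using ConvAlgebra.induction with
    | zero => exact (map_zero σ).trans (map_zero τ).symm
    | delta t a => exact h t a
    | add F K hF hK => rw [of_add, map_add, map_add, hF, hK]

/-- The partial isometries `1_t δ_t` generate the crossed product, if the domains separate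
points. -/
theorem hom_ext_partialIsometry (hθ : θ.SeparatesPoints) {B : Type w} [CStarAlgebra B]
    {σ τ : θ.CrossedProduct →⋆ₙₐ[ℂ] B}
    (h : ∀ t, σ (partialIsometry θ t) = τ (partialIsometry θ t)) : σ = τ := by
  -- Agreement on 1_t δ_t passes to 1_t = (1_t δ_t)(1_t δ_t)^*, and from there to C(X) by separation
  -- of points.
  have h1 : σ.comp (incl θ) = τ.comp (incl θ) := hθ.hom_ext fun t => by
    simp only [NonUnitalStarAlgHom.comp_apply, ← partialIsometry_mul_star, map_mul, map_star, h]
  refine hom_ext fun t a => ?_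
  rw [← incl_mul_partialIsometry, map_mul, map_mul, h]
  exact congrArg (· * _) (DFunLike.congr_fun h1 a.1)

end CrossedProduct

end PartialAction

namespace PartialRep

variable {G : Type u} [Group G] {H : Type w} [NormedAddCommGroup H]
  [InnerProductSpace ℂ H] [CompleteSpace H] (V : PartialRep G H)

/-- The range projection is self-adjoint and idempotent, so its norm n satisfies n² = n, while n =
‖V_t‖². This feeds the domination by the ℓ¹-norm. -/
theorem norm_le_one (t : G) : ‖V t‖ ≤ 1 := by
  have h1 : ‖V.rangeProj t‖ = ‖V t‖ * ‖V t‖ := CStarRing.norm_self_mul_star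
  have h2 : ‖V.rangeProj t‖ * ‖V.rangeProj t‖ = ‖V.rangeProj t‖ := by
    rw [← CStarRing.norm_star_mul_self, star_rangeProj, rangeProj_mul_self]
  rw [h1] at h2
  by_contra! h
  have h3 : 1 < ‖V t‖ * ‖V t‖ := one_lt_mul_of_lt_of_le h h.le
  nlinarith

theorem mul_star_mul (t : G) : V t * star (V t) * V t = V t := by
  rw [← V.map_inv, V.mul_inv_mul]

end PartialRep

/-! ### Covariant pairs and representations of the crossed product -/

section IntegratedForm

open PartialAction

variable {G : Type u} [Group G] {X : Type v} [TopologicalSpace X]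
  {H : Type w} [NormedAddCommGroup H] [InnerProductSpace ℂ H] [CompleteSpace H]
  {θ : PartialAction G X} {π : C(X, ℂ) →⋆ₙₐ[ℂ] (H →L[ℂ] H)} {V : PartialRep G H}

open scoped InnerProductSpace in
/-- The projection onto the closed span of `π(D_t)H` is `π(1_t)`. -/
theorem starProjection_essentialSubspace_ideal (θ : PartialAction G X)
    (π : C(X, ℂ) →⋆ₙₐ[ℂ] (H →L[ℂ] H)) (t : G) :
    (essentialSubspace π (θ.ideal t)).starProjection = π (θ.char t) := by
  ext ξ
  refine Submodule.eq_starProjection_of_mem_of_inner_eq_zero ?_ ?_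
  · exact Submodule.le_topologicalClosure _
      (Submodule.subset_span ⟨_, θ.char_mem_ideal t, ξ, rfl⟩)
  · intro η hη
    refine closure_minimal (s := (Submodule.span ℂ
      {η | ∃ a ∈ (θ.ideal t : Set C(X, ℂ)), ∃ ξ : H, π a ξ = η} : Set H))
      (t := {η | ⟪ξ - π (θ.char t) ξ, η⟫_ℂ = 0}) ?_ (isClosed_eq (by fun_prop) (by fun_prop)) hη
    intro η hη
    induction hη using Submodule.span_induction with
    | mem η hη =>
      obtain ⟨a, ha, ζ, rfl⟩ := hη
      change ⟪ξ - π (θ.char t) ξ, π a ζ⟫_ℂ = 0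
      rw [← ContinuousLinearMap.adjoint_inner_left, ← ContinuousLinearMap.star_eq_adjoint,
        ← map_star, map_sub]
      -- Since 1_t is a unit for D_t, the operator π(a^*) annihilates ξ - π(1_t)ξ, which is
      -- orthogonality to π(a)ζ.
      have : π (star a) * π (θ.char t) = π (star a) := by
        rw [← map_mul]
        refine congrArg π (θ.mul_char fun x hx => ?_)
        rw [ContinuousMap.star_apply, ha x hx, star_zero]
      have h2 : π (star a) (π (θ.char t) ξ) = π (star a) ξ := congrArg (fun T => T ξ) this
      rw [h2, sub_self, inner_zero_left]
    | zero => simp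
    | add x y _ _ hx hy =>
      simp only [Set.mem_ofPred_eq] at hx hy ⊢
      rw [inner_add_right, hx, hy, add_zero]
    | smul c x _ hx =>
      simp only [Set.mem_ofPred_eq] at hx ⊢
      rw [inner_smul_right, hx, mul_zero]

namespace IsCovariant

theorem map_char (h : IsCovariant θ π V) (t : G) : π (θ.char t) = V t * star (V t) := by
  rw [h.range_proj, starProjection_essentialSubspace_ideal]

theorem map_one (h : IsCovariant θ π V) : π 1 = 1 := h.nondegenerate.map_one

theorem map_char_mul (h : IsCovariant θ π V) (t : G) : π (θ.char t) * V t = V t := by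
  rw [h.map_char, V.mul_star_mul]

/-- The initial projection V_t^*V_t equals π(1_{t⁻¹}) and commutes with π(b). So b may be cut down
to D_{t⁻¹}, where covariance applies. -/
theorem mul_map (h : IsCovariant θ π V) (t : G) (b : C(X, ℂ)) :
    V t * π b = π (θ.alpha t b) * V t := by
  have h1 : V t⁻¹ * V t = π (θ.char t⁻¹) := by
    rw [h.map_char, ← V.map_inv, inv_inv]
  have h2 : θ.alpha t b = θ.alpha t (b * θ.char t⁻¹) := by
    rw [alpha_mul, alpha_char, mul_inv_cancel, char_one, mul_one, mul_comm, char_mul_alpha]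
  rw [h2, h.covariance t _ ((θ.ideal _).mul_mem_left _ (θ.char_mem_ideal _)), mul_assoc, h1,
    mul_assoc, ← map_mul, mul_assoc, char_mul_char, mul_comm b, map_mul, ← h1, ← mul_assoc,
    ← mul_assoc, V.mul_inv_mul]

/-- A partial representation satisfies V_t V_t^* V_{ts} = V_t V_s, and π(a) absorbs the projection
V_t V_t^* = π(1_t). -/
theorem map_mul_mul (h : IsCovariant θ π V) {t : G} (s : G) {a : C(X, ℂ)} (ha : a ∈ θ.ideal t) :
    π a * V t * V s = π a * V (t * s) := by
  have h1 := V.map_mul_left (t * s) t⁻¹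
  rw [inv_inv, inv_mul_cancel_left, ← V.rangeProj_eq, PartialRep.rangeProj, ← h.map_char] at h1
  rw [mul_assoc, ← h1, ← mul_assoc, ← map_mul, θ.mul_char ha]

variable (π V) in
/-- The linear map `∑ a_t δ_t ↦ ∑ π(a_t) V_t`. -/
noncomputable def convLinear (θ : PartialAction G X) : θ.ConvAlgebra →ₗ[ℂ] (H →L[ℂ] H) :=
  (Finsupp.lsum ℂ fun t => LinearMap.mulRight ℂ (V t) ∘ₗ (π : C(X, ℂ) →ₗ[ℂ] (H →L[ℂ] H))) ∘ₗ
    ConvAlgebra.coeffs θ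

theorem convLinear_apply (F : θ.ConvAlgebra) :
    convLinear π V θ F = (ConvAlgebra.coeffs θ F).sum fun t a => π a * V t := rfl

theorem convLinear_delta (t : G) (a : θ.ideal t) :
    convLinear π V θ (ConvAlgebra.delta θ t a) = π a * V t := by
  rw [convLinear_apply, ConvAlgebra.coeffs_delta, Finsupp.sum_single_index (by simp)]

/-- On generators, `mul_map` moves π(b) to the left of V_t, giving π(a α_t(b)) V_t V_s; the
coefficient lies in D_t, so `map_mul_mul` replaces V_t V_s by V_{ts}. -/
theorem convLinear_mul (h : IsCovariant θ π V) (F K : θ.ConvAlgebra) :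
    convLinear π V θ (F * K) = convLinear π V θ F * convLinear π V θ K := by
  induction F using ConvAlgebra.induction with
  | zero => simp
  | add F F' hF hF' => simp only [add_mul, map_add, hF, hF']
  | delta t a =>
    induction K using ConvAlgebra.induction with
    | zero => simp
    | add F F' hF hF' => simp only [mul_add, map_add, hF, hF']
    | delta s b =>
      rw [convLinear_delta, convLinear_delta, convLinear_apply]
      change (θ.convMul (Finsupp.single t a.1) (Finsupp.single s b.1)).sum _ = _
      rw [convMul_single, Finsupp.sum_single_index (by simp),
        ← h.map_mul_mul s ((θ.ideal t).mul_mem_right _ a.2), map_mul, mul_assoc (π a.1),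
        ← h.mul_map]
      simp only [mul_assoc]

theorem convLinear_star (h : IsCovariant θ π V) (F : θ.ConvAlgebra) :
    convLinear π V θ (star F) = star (convLinear π V θ F) := by
  induction F using ConvAlgebra.induction with
  | zero => simp
  | add F F' hF hF' => simp only [star_add, map_add, hF, hF']
  | delta t a =>
    rw [ConvAlgebra.star_delta (c := ⟨_, θ.alpha_mem_ideal t⁻¹ (star a.1)⟩) rfl rfl,
      convLinear_delta, convLinear_delta, star_mul, ← map_star, ← V.map_inv, h.mul_map]

variable (π V) in
/-- The seminorm `F ↦ ‖∑ π(F_t) V_t‖`. -/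
noncomputable def convSeminorm (θ : PartialAction G X) : Seminorm ℂ θ.ConvAlgebra :=
  (normSeminorm ℂ (H →L[ℂ] H)).comp (convLinear π V θ)

variable [CompactSpace X]

/-- The C*-identity is inherited from B(H), and the ℓ¹ bound holds because π and every V_t are
contractive. Hence the enveloping norm dominates this seminorm. -/
theorem isCStarSeminorm_convSeminorm (h : IsCovariant θ π V) :
    θ.IsCStarSeminorm (convSeminorm π V θ) where
  mul_le F K := by
    change ‖convLinear π V θ _‖ ≤ ‖convLinear π V θ _‖ * ‖convLinear π V θ _‖
    rw [h.convLinear_mul]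
    exact norm_mul_le _ _
  star_mul_self F := by
    change ‖convLinear π V θ _‖ = ‖convLinear π V θ _‖ ^ 2
    rw [h.convLinear_mul, h.convLinear_star, CStarRing.norm_star_mul_self, sq]
  le_l1Norm F := by
    change ‖convLinear π V θ F‖ ≤ _
    refine (norm_sum_le _ _).trans (Finset.sum_le_sum fun t _ => ?_)
    calc ‖π (F.1 t) * V t‖ ≤ ‖π (F.1 t)‖ * ‖V t‖ := norm_mul_le _ _
      _ ≤ ‖F.1 t‖ * 1 := mul_le_mul (NonUnitalStarAlgHom.norm_apply_le π _) (V.norm_le_one t)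
          (norm_nonneg _) (norm_nonneg _)
      _ = ‖F.1 t‖ := mul_one _

theorem norm_convLinear_le (h : IsCovariant θ π V) (F : θ.ConvAlgebra) :
    ‖convLinear π V θ F‖ ≤ ‖F‖ :=
  θ.le_envNorm ⟨_, h.isCStarSeminorm_convSeminorm⟩ F

theorem uniformContinuous_convLinear (h : IsCovariant θ π V) :
    UniformContinuous (convLinear π V θ) :=
  (AddMonoidHomClass.lipschitz_of_bound (convLinear π V θ) 1 fun F => by
    simpa using h.norm_convLinear_le F).uniformContinuous

theorem exists_integratedForm (h : IsCovariant θ π V) :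
    ∃ σ : θ.CrossedProduct →⋆ₙₐ[ℂ] (H →L[ℂ] H), IsIntegratedForm θ π V σ := by
  -- Extend by continuity; each algebraic identity is a closed condition, so it carries over from
  -- the dense convolution algebra.
  let f : θ.CrossedProduct → (H →L[ℂ] H) := UniformSpace.Completion.extension (convLinear π V θ)
  have hc : Continuous f := UniformSpace.Completion.continuous_extension
  have hf (F : θ.ConvAlgebra) : f (CrossedProduct.of θ F) = convLinear π V θ F :=
    UniformSpace.Completion.extension_coe h.uniformContinuous_convLinear F
  have hsmul (c : ℂ) (x) : f (c • x) = c • f x := by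
    induction x using CrossedProduct.induction_of with
    | hc => exact isClosed_eq (hc.comp (continuous_const_smul c)) (hc.const_smul c)
    | h F => rw [← CrossedProduct.of_smul, hf, hf, map_smul]
  have hadd (x y) : f (x + y) = f x + f y := by
    induction x using CrossedProduct.induction_of with
    | hc => exact isClosed_eq (hc.comp (continuous_id.add continuous_const))
              (hc.add continuous_const)
    | h F =>
      induction y using CrossedProduct.induction_of with
      | hc => exact isClosed_eq (hc.comp (continuous_const.add continuous_id))
                (continuous_const.add hc)
      | h K => rw [← CrossedProduct.of_add, hf, hf, hf, map_add]
  have hmul (x y) : f (x * y) = f x * f y := by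
    induction x using CrossedProduct.induction_of with
    | hc => exact isClosed_eq (hc.comp (continuous_id.mul continuous_const))
              (hc.mul continuous_const)
    | h F =>
      induction y using CrossedProduct.induction_of with
      | hc => exact isClosed_eq (hc.comp (continuous_const.mul continuous_id))
                (continuous_const.mul hc)
      | h K => rw [← CrossedProduct.of_mul, hf, hf, hf, h.convLinear_mul]
  have hstar (x) : f (star x) = star (f x) := by
    induction x using CrossedProduct.induction_of with
    | hc => exact isClosed_eq (hc.comp (CrossedProduct.continuous_star' θ)) hc.star
    | h F => rw [CrossedProduct.star_of, hf, hf, h.convLinear_star]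
  refine ⟨{ toFun := f, map_smul' := hsmul, map_zero' := ?_, map_add' := hadd, map_mul' := hmul,
            map_star' := hstar }, fun t a => ?_⟩
  · simpa using hsmul 0 0
  · exact (hf _).trans (convLinear_delta t a)

theorem existsUnique_integratedForm (h : IsCovariant θ π V) :
    ∃! σ : θ.CrossedProduct →⋆ₙₐ[ℂ] (H →L[ℂ] H), IsIntegratedForm θ π V σ := by
  obtain ⟨σ, hσ⟩ := h.exists_integratedForm
  exact ⟨σ, hσ, fun τ hτ => CrossedProduct.hom_ext fun t a => (hτ t a).trans (hσ t a).symm⟩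

end IsCovariant

variable [CompactSpace X]

/-- The partial representation `t ↦ σ(1_t δ_t)` of a unital representation `σ`. -/
noncomputable def partialRepOfCrossedProduct (σ : θ.CrossedProduct →⋆ₙₐ[ℂ] (H →L[ℂ] H)) (h : σ 1 = 1) :
    PartialRep G H where
  toFun t := σ (CrossedProduct.partialIsometry θ t)
  map_one := by rw [CrossedProduct.partialIsometry_one, h]
  map_inv t := by rw [CrossedProduct.partialIsometry_inv, map_star]
  map_mul s t := by
    rw [← map_mul, ← map_mul, CrossedProduct.partialIsometry_mul_mul_inv, map_mul]

theorem partialRepOfCrossedProduct_apply (σ : θ.CrossedProduct →⋆ₙₐ[ℂ] (H →L[ℂ] H))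
    (h : σ 1 = 1) (t : G) :
    partialRepOfCrossedProduct σ h t = σ (CrossedProduct.partialIsometry θ t) := rfl

theorem isCovariant_of_crossedProduct (σ : θ.CrossedProduct →⋆ₙₐ[ℂ] (H →L[ℂ] H)) (h : σ 1 = 1) :
    IsCovariant θ (σ.comp (CrossedProduct.incl θ)) (partialRepOfCrossedProduct σ h) where
  nondegenerate := isNondegenerate_of_map_one h
  range_proj t := by
    rw [starProjection_essentialSubspace_ideal, partialRepOfCrossedProduct_apply, ← map_star,
      ← map_mul, CrossedProduct.partialIsometry_mul_star]
    rfl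
  covariance t a _ := by
    simp only [NonUnitalStarAlgHom.comp_apply, partialRepOfCrossedProduct_apply,
      CrossedProduct.incl_alpha, map_mul]

theorem isIntegratedForm_of_crossedProduct (σ : θ.CrossedProduct →⋆ₙₐ[ℂ] (H →L[ℂ] H))
    (h : σ 1 = 1) : IsIntegratedForm θ (σ.comp (CrossedProduct.incl θ))
      (partialRepOfCrossedProduct σ h) σ := fun t a => by
  rw [← CrossedProduct.incl_mul_partialIsometry, map_mul]
  rfl

theorem IsIntegratedForm.map_incl {σ : θ.CrossedProduct →⋆ₙₐ[ℂ] (H →L[ℂ] H)}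
    (hσ : IsIntegratedForm θ π V σ) (a : C(X, ℂ)) : σ (CrossedProduct.incl θ a) = π a := by
  rw [CrossedProduct.incl_apply, hσ, V.map_one, mul_one]

theorem IsIntegratedForm.map_partialIsometry {σ : θ.CrossedProduct →⋆ₙₐ[ℂ] (H →L[ℂ] H)}
    (hσ : IsIntegratedForm θ π V σ) (hc : IsCovariant θ π V) (t : G) :
    σ (CrossedProduct.partialIsometry θ t) = V t := by
  rw [CrossedProduct.partialIsometry, hσ, hc.map_char_mul]

/-- Evaluating the integrated form at a δ_e and at 1_t δ_t recovers π(a) and V_t, so these formulas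
both define the pair and show that it is unique. -/
theorem existsUnique_covariant {σ : θ.CrossedProduct →⋆ₙₐ[ℂ] (H →L[ℂ] H)}
    (hσ : IsNondegenerate σ) :
    ∃! p : (C(X, ℂ) →⋆ₙₐ[ℂ] (H →L[ℂ] H)) × PartialRep G H,
      IsCovariant θ p.1 p.2 ∧ IsIntegratedForm θ p.1 p.2 σ := by
  refine ⟨(σ.comp (CrossedProduct.incl θ), partialRepOfCrossedProduct σ hσ.map_one),
    ⟨isCovariant_of_crossedProduct σ hσ.map_one,
      isIntegratedForm_of_crossedProduct σ hσ.map_one⟩, ?_⟩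
  rintro ⟨π, V⟩ ⟨hc, hi⟩
  refine Prod.ext (NonUnitalStarAlgHom.ext fun a => (hi.map_incl a).symm) ?_
  exact PartialRep.ext (funext fun t => (hi.map_partialIsometry hc t).symm)

/-- If the domains separate points, the range of `π × V` is `C^*({V_t})`. -/
theorem IsIntegratedForm.range_eq (hθ : θ.SeparatesPoints)
    {σ : θ.CrossedProduct →⋆ₐ[ℂ] (H →L[ℂ] H)}
    (hσ : IsIntegratedForm θ π V σ) (hc : IsCovariant θ π V) :
    Set.range σ = (V.cStar : Set (H →L[ℂ] H)) := by
  open scoped CStarAlgebra in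
  have hclosed : IsClosed (V.cStar : Set (H →L[ℂ] H)) :=
    StarSubalgebra.isClosed_topologicalClosure _
  apply Set.Subset.antisymm
  · rintro _ ⟨x, rfl⟩
    induction x using CrossedProduct.induction_of with
    | hc => exact hclosed.preimage (map_continuous σ)
    | h F =>
      induction F using ConvAlgebra.induction with
      | zero => exact (map_zero σ).symm ▸ V.cStar.zero_mem
      | add F K hF hK => rw [CrossedProduct.of_add, map_add]; exact add_mem hF hK
      | delta t a =>
        have h1 : σ (CrossedProduct.of θ (ConvAlgebra.delta θ t a)) = π a * V t := hσ t a
        rw [h1]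
        -- Separation of points reduces membership of π(a) to that of π(1_s) = V_s V_s^*.
        refine mul_mem (hθ.map_mem π V.cStar hclosed (fun s => ?_) a.1) (V.mem_cStar t)
        rw [hc.map_char]
        exact mul_mem (V.mem_cStar s) (star_mem (V.mem_cStar s))
  -- The range contains each V_t and is closed, so it contains the C*-algebra they generate.
  · have h : V.cStar ≤ σ.range := by
      refine StarSubalgebra.topologicalClosure_minimal (StarAlgebra.adjoin_le ?_) ?_
      · rintro _ ⟨t, rfl⟩
        exact ⟨_, hσ.map_partialIsometry hc t⟩
      · exact σ.isClosed_range
    exact h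

end IntegratedForm

/-! ### Partial representations satisfying relations -/

section Relations

open PartialAction

variable {G : Type u} [Group G]

theorem separatesPoints_canonicalAction : (canonicalAction G).SeparatesPoints := fun _ _ h =>
  Subtype.ext (funext fun t => Bool.eq_iff_iff.2 (h t))

theorem separatesPoints_spectrumAction (R : Set C(XG G, ℂ)) :
    (spectrumAction R).SeparatesPoints := fun x y h =>
  Subtype.ext (separatesPoints_canonicalAction x.1 y.1 h)

/-- Restriction to Ω_R intertwines the two actions; this carries covariance from C(X_G) down to
C(Ω_R). -/
theorem alpha_spectrumAction (R : Set C(XG G, ℂ)) (t : G) (f : C(XG G, ℂ)) :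
    (spectrumAction R).alpha t (f.restrict (spectrumOf R)) =
      ((canonicalAction G).alpha t f).restrict (spectrumOf R) := by
  ext x
  by_cases hx : x.1 ∈ (canonicalAction G).dom t
  · have hx' : x ∈ (spectrumAction R).dom t := hx
    have hx'' : x.1 ∈ (canonicalAction G).dom t⁻¹⁻¹ := by rwa [inv_inv]
    rw [alpha_apply_mem _ hx', ContinuousMap.restrict_apply, ContinuousMap.restrict_apply,
      alpha_apply_mem _ hx]
    exact congrArg (fun y : spectrumOf R => f y) (dif_pos hx'')
  · have hx' : x ∉ (spectrumAction R).dom t := hx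
    rw [alpha_apply_notMem _ hx', ContinuousMap.restrict_apply, alpha_apply_notMem _ hx]

/-- The restriction homomorphism `C(X_G) → C(Ω_R)`. -/
noncomputable def restrictHom (R : Set C(XG G, ℂ)) :
    C(XG G, ℂ) →⋆ₙₐ[ℂ] C(spectrumOf R, ℂ) where
  toFun f := f.restrict (spectrumOf R)
  map_smul' _ _ := rfl
  map_zero' := rfl
  map_add' _ _ := rfl
  map_mul' _ _ := rfl
  map_star' _ := rfl

theorem restrictHom_apply (R : Set C(XG G, ℂ)) (f : C(XG G, ℂ)) :
    restrictHom R f = f.restrict (spectrumOf R) := rfl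

/-- Tietze extension applies because Ω_R is closed in X_G. -/
theorem restrictHom_surjective (R : Set C(XG G, ℂ)) : Function.Surjective (restrictHom R) :=
  fun f => ContinuousMap.exists_restrict_eq (isClosed_spectrumOf R) f

theorem translate_one (ω : XG G) : ω.translate 1 = ω := (canonicalAction G).act_one ω

variable {H : Type w} [NormedAddCommGroup H] [InnerProductSpace ℂ H] [CompleteSpace H]
  {R : Set C(XG G, ℂ)}

namespace PartialRep

variable {V : PartialRep G H}

theorem rho_eq {ρ : C(XG G, ℂ) →⋆ₙₐ[ℂ] (H →L[ℂ] H)}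
    (h : ∀ t, ρ ((canonicalAction G).char t) = V t * star (V t)) : V.rho = ρ :=
  V.existsUnique_rho.unique V.rho_char h

/-- Composing ρ with restriction gives a representation with the values that characterize ρ_V, so it
is ρ_V; and every relation vanishes on Ω_R. -/
theorem satisfies_of_isCovariant {ρ : C(spectrumOf R, ℂ) →⋆ₙₐ[ℂ] (H →L[ℂ] H)}
    (h : IsCovariant (spectrumAction R) ρ V) : V.Satisfies R := by
  have h1 : V.rho = ρ.comp (restrictHom R) := rho_eq fun t => h.map_char t
  intro f hf
  have h2 : restrictHom R f = 0 := by
    ext ω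
    -- The defining condition of the spectrum at t = e.
    have := ω.2 1 ω.1.2 f hf
    rwa [inv_one, translate_one] at this
  rw [h1, NonUnitalStarAlgHom.comp_apply, h2, map_zero]

variable (V) in
theorem rho_one : V.rho 1 = 1 := by
  rw [← (canonicalAction G).char_one, rho_char, V.map_one, star_one, one_mul]

variable (V) in
/-- `f ↦ V_t ρ_V(f) V_t^*` is a homomorphism. -/
noncomputable def conjRho (t : G) : C(XG G, ℂ) →⋆ₙₐ[ℂ] (H →L[ℂ] H) where
  toFun f := V t * V.rho f * star (V t)
  map_smul' c f := by simp
  map_zero' := by simp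
  map_add' f g := by simp [mul_add, add_mul]
  map_mul' f g := by
    -- Multiplicativity works because V_t^*V_t lies in the commutative range of ρ_V and V_t absorbs
    -- it.
    have h1 : star (V t) * V t = V.rho ((canonicalAction G).char t⁻¹) := by
      rw [rho_char, V.map_inv, star_star]
    calc V t * V.rho (f * g) * star (V t)
        = V t * (star (V t) * V t) * (V.rho (f * g)) * star (V t) := by
          rw [← mul_assoc (V t), V.mul_star_mul]
      _ = V t * V.rho f * (star (V t) * V t) * V.rho g * star (V t) := by
          rw [h1, mul_assoc (V t), ← _root_.map_mul, mul_comm, mul_assoc, mul_assoc, mul_assoc,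
            mul_assoc, mul_assoc, ← mul_assoc (V.rho _) (V.rho g), ← _root_.map_mul,
            ← mul_assoc (V.rho f), ← _root_.map_mul]
          congr 3
          ring
      _ = _ := by simp only [mul_assoc]
  map_star' f := by rw [map_star]; simp [mul_assoc]

variable (V) in
/-- `f ↦ ρ_V(α_t(f))` is a homomorphism. -/
noncomputable def rhoAlpha (t : G) : C(XG G, ℂ) →⋆ₙₐ[ℂ] (H →L[ℂ] H) where
  toFun f := V.rho ((canonicalAction G).alpha t f)
  map_smul' c f := by rw [alpha_smul, map_smul]; rfl
  map_zero' := by rw [alpha_zero, map_zero]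
  map_add' f g := by rw [alpha_add, map_add]
  map_mul' f g := by rw [alpha_mul, _root_.map_mul]
  map_star' f := by rw [alpha_star, map_star]

variable (V) in
-- Both sides are homomorphisms in f, so it suffices to compare them on 1_s, where the identity is
-- V_t e(s) = e(ts) V_t for the range projections e. It makes the kernel of ρ_V invariant.
theorem rho_alpha (t : G) (f : C(XG G, ℂ)) :
    V.rho ((canonicalAction G).alpha t f) = V t * V.rho f * star (V t) := by
  have h : V.rhoAlpha t = V.conjRho t := separatesPoints_canonicalAction.hom_ext fun s => by
    change V.rho _ = V t * V.rho _ * star (V t)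
    rw [alpha_char, mul_comm, _root_.map_mul, rho_char, rho_char, rho_char]
    have := V.mul_rangeProj t s
    rw [rangeProj, rangeProj] at this
    rw [this]
    simp only [mul_assoc]
  exact DFunLike.congr_fun h f

open scoped CStarAlgebra in
/-- If `V` satisfies `R`, then `ρ_V(f) = 0` for all `f` vanishing on the spectrum. -/
theorem Satisfies.rho_eq_zero (hV : V.Satisfies R) {f : C(XG G, ℂ)} (hf : restrictHom R f = 0) :
    V.rho f = 0 := by
  -- The kernel is a closed ideal, hence consists of all functions vanishing on its common zeros; it
  -- remains to place these zeros in the spectrum.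
  let I : Ideal C(XG G, ℂ) :=
    { carrier := {f | V.rho f = 0}
      add_mem' := fun {a b} ha hb => by
        change V.rho (a + b) = 0
        rw [map_add, show V.rho a = 0 from ha, show V.rho b = 0 from hb, add_zero]
      zero_mem' := map_zero _
      smul_mem' := fun c a ha => by
        change V.rho (c * a) = 0
        rw [_root_.map_mul, show V.rho a = 0 from ha, mul_zero] }
  have hI : IsClosed (I : Set C(XG G, ℂ)) := isClosed_eq (map_continuous V.rho) continuous_const
  change f ∈ I
  rw [← ContinuousMap.idealOfSet_ofIdeal_isClosed hI, ContinuousMap.mem_idealOfSet]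
  intro ω hω
  have hω' : ω ∈ spectrumOf R := by
    intro t ht g hg
    -- For t ∈ ω the value of α_t(g) at ω is g(t⁻¹ω), so membership in the kernel yields exactly the
    -- condition defining Ω_R.
    have h1 : (canonicalAction G).alpha t g ∈ I := by
      change V.rho _ = 0
      rw [rho_alpha, hV g hg, mul_zero, zero_mul]
    have h2 := ContinuousMap.notMem_setOfIdeal.1 hω h1
    rwa [alpha_apply_mem _ (show ω ∈ (canonicalAction G).dom t from ht)] at h2
  exact DFunLike.congr_fun hf ⟨ω, hω'⟩

/-- If `V` satisfies `R`, then `ρ_V` factors through `C(Ω_R)`. -/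
theorem Satisfies.exists_factor (hV : V.Satisfies R) :
    ∃ ρ : C(spectrumOf R, ℂ) →⋆ₙₐ[ℂ] (H →L[ℂ] H), ∀ f, ρ (restrictHom R f) = V.rho f := by
  -- The chosen extensions `e f` need not depend linearly on f, but by `key` their images under ρ_V
  -- depend only on the restriction to Ω_R.
  let e := Function.surjInv (restrictHom_surjective R)
  have he (f) : restrictHom R (e f) = f := Function.surjInv_eq _ f
  have key (f g) (h : restrictHom R f = restrictHom R g) : V.rho f = V.rho g := by
    rw [← sub_eq_zero, ← map_sub]
    exact hV.rho_eq_zero (by rw [map_sub, h, sub_self])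
  refine ⟨{ toFun := fun f => V.rho (e f), map_smul' := fun c f => ?_, map_zero' := ?_,
            map_add' := fun f g => ?_, map_mul' := fun f g => ?_, map_star' := fun f => ?_ },
    fun f => key _ _ (he _)⟩
  · rw [← map_smul]; exact key _ _ (by rw [he, map_smul, he]; rfl)
  · rw [← map_zero V.rho]; exact key _ _ (by rw [he, map_zero])
  · rw [← map_add]; exact key _ _ (by rw [he, map_add, he, he])
  · rw [← _root_.map_mul]; exact key _ _ (by rw [he, _root_.map_mul, he, he])
  · rw [← map_star]; exact key _ _ (by rw [he, map_star, he])

/-- The factor of ρ_V through C(Ω_R) does the job: covariance descends from `rho_alpha` by lifting a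
to X_G, and uniqueness holds because the 1_t generate C(Ω_R). -/
theorem Satisfies.exists_isCovariant (hV : V.Satisfies R) :
    ∃ ρ : C(spectrumOf R, ℂ) →⋆ₙₐ[ℂ] (H →L[ℂ] H),
      (∀ t, ρ ((spectrumAction R).char t) = V t * star (V t)) ∧
      (∀ ρ' : C(spectrumOf R, ℂ) →⋆ₙₐ[ℂ] (H →L[ℂ] H),
        (∀ t, ρ' ((spectrumAction R).char t) = V t * star (V t)) → ρ' = ρ) ∧
      IsCovariant (spectrumAction R) ρ V := by
  obtain ⟨ρ, hρ⟩ := hV.exists_factor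
  have hchar (t) : ρ ((spectrumAction R).char t) = V t * star (V t) :=
    (hρ _).trans (V.rho_char t)
  refine ⟨ρ, hchar, fun ρ' hρ' => (separatesPoints_spectrumAction R).hom_ext fun t => ?_, ?_⟩
  · rw [hρ', hchar]
  · refine ⟨isNondegenerate_of_map_one ((hρ 1).trans V.rho_one), fun t => ?_, fun t a _ => ?_⟩
    · rw [starProjection_essentialSubspace_ideal, hchar]
    · obtain ⟨f, rfl⟩ := restrictHom_surjective R a
      rw [restrictHom_apply, alpha_spectrumAction, ← restrictHom_apply, ← restrictHom_apply, hρ,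
        hρ, rho_alpha, V.map_inv]

/-- A partial representation satisfying `R` integrates to the crossed product. -/
theorem Satisfies.exists_starAlgHom (hV : V.Satisfies R) :
    ∃ σ : (spectrumAction R).CrossedProduct →⋆ₐ[ℂ] (H →L[ℂ] H),
      (∀ t, σ (CrossedProduct.partialIsometry (spectrumAction R) t) = V t) ∧
      Set.range σ = (V.cStar : Set (H →L[ℂ] H)) := by
  obtain ⟨ρ, -, -, hc⟩ := hV.exists_isCovariant
  obtain ⟨σ, hσ⟩ := hc.exists_integratedForm
  have h1 : σ 1 = 1 := by rw [← CrossedProduct.incl_one, hσ.map_incl, hc.map_one]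
  exact ⟨σ.toStarAlgHomOfMapOne h1, fun t => hσ.map_partialIsometry hc t,
    IsIntegratedForm.range_eq (σ := σ.toStarAlgHomOfMapOne h1)
      (separatesPoints_spectrumAction R) hσ hc⟩

/-- A representation of the crossed product with `1_t δ_t ↦ V_t`, as a map onto `C^*({V_t})`. -/
theorem Satisfies.exists_surjective (hV : V.Satisfies R) :
    ∃ σ : (spectrumAction R).CrossedProduct →⋆ₐ[ℂ] V.cStar, Function.Surjective σ ∧
      ∀ t, σ (CrossedProduct.partialIsometry (spectrumAction R) t) = V.gen t := by
  obtain ⟨σ, hσ, hr⟩ := hV.exists_starAlgHom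
  refine ⟨σ.codRestrict V.cStar fun x => ?_, fun y => ?_, fun t => Subtype.ext (hσ t)⟩
  · change σ x ∈ (V.cStar : Set (H →L[ℂ] H))
    exact hr ▸ ⟨x, rfl⟩
  · have hy : (y : H →L[ℂ] H) ∈ Set.range σ := hr ▸ y.2
    obtain ⟨x, hx⟩ := hy
    exact ⟨x, Subtype.ext hx⟩

/-- Homomorphisms of the crossed product to `C^*({V_t})` are determined by the images of the
elements `1_t δ_t`. -/
theorem starAlgHom_cStar_ext {σ τ : (spectrumAction R).CrossedProduct →⋆ₐ[ℂ] V.cStar}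
    (h : ∀ t, σ (CrossedProduct.partialIsometry (spectrumAction R) t) =
      τ (CrossedProduct.partialIsometry (spectrumAction R) t)) : σ = τ := by
  have h1 : ((V.cStar.subtype.comp σ : _ →⋆ₐ[ℂ] (H →L[ℂ] H)) :
      (spectrumAction R).CrossedProduct →⋆ₙₐ[ℂ] (H →L[ℂ] H)) = V.cStar.subtype.comp τ :=
    CrossedProduct.hom_ext_partialIsometry (separatesPoints_spectrumAction R) fun t =>
      congrArg Subtype.val (h t)
  exact StarAlgHom.ext fun x => Subtype.ext (DFunLike.congr_fun h1 x)

end PartialRep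

/-! ### Universal partial representations and the crossed product -/

variable (R) in
/-- There is a partial representation satisfying `R` whose integrated form is faithful. -/
theorem exists_faithful_partialRep : ∃ (K : Type (max u w)) (_ : NormedAddCommGroup K)
    (_ : InnerProductSpace ℂ K) (_ : CompleteSpace K) (V : PartialRep G K)
    (σ : (spectrumAction R).CrossedProduct →⋆ₐ[ℂ] V.cStar), V.Satisfies R ∧
      Function.Bijective σ ∧
      ∀ t, σ (CrossedProduct.partialIsometry (spectrumAction R) t) = V.gen t := by
  obtain ⟨K, _, _, _, π, hπ⟩ := exists_faithful_representation.{u, w}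
    (spectrumAction R).CrossedProduct
  let π' : (spectrumAction R).CrossedProduct →⋆ₙₐ[ℂ] (K →L[ℂ] K) := π
  have h1 : π' 1 = 1 := map_one π
  let V := partialRepOfCrossedProduct π' h1
  have hV : V.Satisfies R := PartialRep.satisfies_of_isCovariant
    (isCovariant_of_crossedProduct π' h1)
  obtain ⟨σ, hs, hσ⟩ := hV.exists_surjective
  refine ⟨K, _, _, _, V, σ, hV, ⟨fun x y hxy => hπ ?_, hs⟩, hσ⟩
  -- The integrated form of V agrees with the faithful π on the generators 1_t δ_t, so it inherits
  -- injectivity.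
  have h2 : ((V.cStar.subtype.comp σ : _ →⋆ₐ[ℂ] (K →L[ℂ] K)) :
      (spectrumAction R).CrossedProduct →⋆ₙₐ[ℂ] (K →L[ℂ] K)) = π' :=
    CrossedProduct.hom_ext_partialIsometry (separatesPoints_spectrumAction R) fun t =>
      congrArg Subtype.val (hσ t)
  have h3 (z) : (σ z : K →L[ℂ] K) = π z := DFunLike.congr_fun h2 z
  rw [← h3, ← h3, hxy]

variable (R) in
-- Once C*({V_t}) is identified with the crossed product, the required map onto C*({W_t}) is the
-- integrated form of W.
theorem exists_isUniversal : ∃ (K : Type u) (_ : NormedAddCommGroup K)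
    (_ : InnerProductSpace ℂ K) (_ : CompleteSpace K) (v : PartialRep G K),
      IsUniversal.{u, u, v} R v := by
  obtain ⟨K, i₁, i₂, i₃, V, σ, hV, hb, hσ⟩ := exists_faithful_partialRep.{u, u} R
  refine ⟨K, i₁, i₂, i₃, V, hV, fun H _ _ _ W hW => ?_⟩
  obtain ⟨τ, hs, hτ⟩ := hW.exists_surjective
  let Φ := StarAlgEquiv.ofBijective σ hb
  refine ⟨τ.comp (Φ.symm : V.cStar →⋆ₐ[ℂ] _), hs.comp fun x => ⟨Φ x, Φ.symm_apply_apply x⟩, fun t => ?_⟩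
  have h : Φ.symm (V.gen t) = CrossedProduct.partialIsometry (spectrumAction R) t := by
    rw [StarAlgEquiv.symm_apply_eq]
    exact (hσ t).symm
  change τ (Φ.symm (V.gen t)) = _
  rw [h, hτ]

/-- Universality is applied to a W with faithful integrated form τ: the map φ it provides satisfies
φ ∘ σ = τ on generators, so σ is injective. The universe `max u v` leaves room for the Hilbert space
of such a W. -/
theorem IsUniversal.existsUnique_equiv {v : PartialRep G H}
    (hv : IsUniversal.{u, w, max u v} R v) :
    ∃! Φ : (spectrumAction R).CrossedProduct ≃⋆ₐ[ℂ] v.cStar,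
      ∀ t, Φ (CrossedProduct.partialIsometry (spectrumAction R) t) = v.gen t := by
  obtain ⟨K, _, _, _, W, τ, hW, hb, hτ⟩ := exists_faithful_partialRep.{u, v} R
  obtain ⟨σ, hs, hσ⟩ := hv.1.exists_surjective
  obtain ⟨φ, -, hφ⟩ := hv.2 K W hW
  have h1 : φ.comp σ = τ := PartialRep.starAlgHom_cStar_ext fun t => by
    rw [StarAlgHom.comp_apply, hσ, hφ, hτ]
  have hinj : Function.Injective σ := by
    refine Function.Injective.of_comp (f := φ) ?_
    rw [← StarAlgHom.coe_comp, h1]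
    exact hb.1
  refine ⟨StarAlgEquiv.ofBijective σ ⟨hinj, hs⟩, hσ, fun Ψ hΨ => ?_⟩
  have h2 : (Ψ : _ →⋆ₐ[ℂ] v.cStar) = σ := PartialRep.starAlgHom_cStar_ext fun t =>
    (hΨ t).trans (hσ t).symm
  exact StarAlgEquiv.ext fun x => DFunLike.congr_fun h2 x

end Relations

/-! ### The main theorem -/

theorem mainTheorem3 {G : Type u} [Group G] (R : Set C(XG G, ℂ)) :
    -- (i) covariant representations `(ρ, V)` of `(C(Ω_R), G, α)` integrate to representations
    -- `ρ × V` of `C(Ω_R) ⋊ G`, and `V` satisfies `R`;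
    (∀ (H : Type v) [NormedAddCommGroup H] [InnerProductSpace ℂ H] [CompleteSpace H]
      (ρ : C(spectrumOf R, ℂ) →⋆ₙₐ[ℂ] (H →L[ℂ] H)) (V : PartialRep G H),
      IsCovariant (spectrumAction R) ρ V →
        (∃! σ : (spectrumAction R).CrossedProduct →⋆ₙₐ[ℂ] (H →L[ℂ] H),
          IsIntegratedForm (spectrumAction R) ρ V σ) ∧
        V.Satisfies R) ∧
    -- and every nondegenerate representation of `C(Ω_R) ⋊ G` is a `ρ × V` for exactly one
    -- covariant pair `(ρ, V)`.
    (∀ (H : Type v) [NormedAddCommGroup H] [InnerProductSpace ℂ H] [CompleteSpace H]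
      (σ : (spectrumAction R).CrossedProduct →⋆ₙₐ[ℂ] (H →L[ℂ] H)), IsNondegenerate σ →
        ∃! p : (C(spectrumOf R, ℂ) →⋆ₙₐ[ℂ] (H →L[ℂ] H)) × PartialRep G H,
          IsCovariant (spectrumAction R) p.1 p.2 ∧
          IsIntegratedForm (spectrumAction R) p.1 p.2 σ) ∧
    -- (ii) if `V` satisfies `R`, then `1_t ↦ V_t V_t^*` extends uniquely to a representation
    -- `ρ_V` of `C(Ω_R)`, and `(ρ_V, V)` is covariant;
    (∀ (H : Type v) [NormedAddCommGroup H] [InnerProductSpace ℂ H] [CompleteSpace H]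
      (V : PartialRep G H), V.Satisfies R →
        ∃ ρ : C(spectrumOf R, ℂ) →⋆ₙₐ[ℂ] (H →L[ℂ] H),
          (∀ t, ρ ((spectrumAction R).char t) = V t * star (V t)) ∧
          (∀ ρ' : C(spectrumOf R, ℂ) →⋆ₙₐ[ℂ] (H →L[ℂ] H),
            (∀ t, ρ' ((spectrumAction R).char t) = V t * star (V t)) → ρ' = ρ) ∧
          IsCovariant (spectrumAction R) ρ V) ∧
    -- hence `(ρ, V) ↦ V` is a bijection from the covariant representations of `(C(Ω_R), G, α)`
    -- onto the partial representations of `G` satisfying `R`.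
    (∀ (H : Type v) [NormedAddCommGroup H] [InnerProductSpace ℂ H] [CompleteSpace H],
      Set.BijOn Prod.snd
        {p : (C(spectrumOf R, ℂ) →⋆ₙₐ[ℂ] (H →L[ℂ] H)) × PartialRep G H |
          IsCovariant (spectrumAction R) p.1 p.2}
        {V : PartialRep G H | V.Satisfies R}) ∧
    -- (iii) a universal partial representation for `R` exists,
    (∃ (K : Type u) (_ : NormedAddCommGroup K) (_ : InnerProductSpace ℂ K)
      (_ : CompleteSpace K) (v : PartialRep G K), IsUniversal.{u, u, max u w} R v) ∧
    -- and for every universal `v` the `C^*`-algebra `C^*_p(G; R) = C^*({v_t})` is canonically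
    -- isomorphic to `C(Ω_R) ⋊ G`.
    (∀ (K : Type v) [NormedAddCommGroup K] [InnerProductSpace ℂ K] [CompleteSpace K]
      (v : PartialRep G K), IsUniversal.{u, v, max u w} R v →
        ∃! Φ : (spectrumAction R).CrossedProduct ≃⋆ₐ[ℂ] v.cStar,
          ∀ t, Φ (PartialAction.CrossedProduct.partialIsometry (spectrumAction R) t)
            = v.gen t) := by 
  refine ⟨fun H _ _ _ ρ V h => ⟨h.existsUnique_integratedForm, PartialRep.satisfies_of_isCovariant h⟩,
    fun H _ _ _ σ hσ => existsUnique_covariant hσ, fun H _ _ _ V hV => hV.exists_isCovariant,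
    fun H _ _ _ => ⟨?_, ?_, ?_⟩, exists_isUniversal R, fun K _ _ _ v hv => hv.existsUnique_equiv⟩
  · rintro ⟨ρ, V⟩ h
    exact PartialRep.satisfies_of_isCovariant h
  -- Injectivity: V determines ρ, since ρ(1_t) = V_t V_t^* and the 1_t generate C(Ω_R).
  · rintro ⟨ρ, V⟩ h ⟨ρ', V'⟩ h' rfl
    refine Prod.ext ((separatesPoints_spectrumAction R).hom_ext fun t => ?_) rfl
    exact (IsCovariant.map_char h t).trans (IsCovariant.map_char h' t).symm
  · intro V hV
    obtain ⟨ρ, -, -, hc⟩ := PartialRep.Satisfies.exists_isCovariant hV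
    exact ⟨(ρ, V), hc, rfl⟩
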